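/- **Setting.** Let $a>0$ and $s>0$ with $s-\frac12\notin\mathbb N_0=\{0,1,2,\dots\}$, and put $m=\lfloor s-\frac12\rfloor$ (so $m=-1$ if $s<\frac12$). For a Schwartz function $\varphi\in\mathcal S(\mathbb R)$ let $\Delta^{s/2}\varphi=\mathcal F^{-1}(|\cdot|^s\mathcal F\varphi)$, where $\mathcal F\varphi(\xi)=\frac1{\sqrt{2\pi}}\int_{\mathbb R}\varphi(x)e^{-ix\xi}\,dx$. For a locally integrable function $f$ on $\mathbb R$ defining a tempered distribution, say that $\Delta^{s/2}f$ exists in $L^2$ and equals $h\in L^2(\mathbb R)$ if there are $\varphi_n\in\mathcal S$ with $\int\varphi_n\psi\to\int f\psi$ for every $\psi\in\mathcal S$ such that $\int x^k\psi\,dx=0$ for all integers $0\le k\le m$ (that is, $\varphi_n\to f$ in $\mathcal S'$ modulo polynomials of degree at most $m$), and $\Delta^{s/2}\varphi_n\to h$ in $L^2(\mathbb R)$. Let $E^{s,2}$ be the space of functions $f:\mathbb R\to\mathbb C$ such that $\Delta^{s/2}f$ exists in $L^2$ and * if $s<\frac12$: $f\in L^{p^*}(\mathbb R)$ with $\frac1{p^*}=\frac12-s$;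 * if $s>\frac12$: $f$ belongs to the homogeneous Lipschitz space $\dot\Lambda^{s-\frac12}$ (i.e. $f\in C^m$ and $f^{(m)}$ is Hölder continuous of order $s-\frac12-m$ on $\mathbb R$) and $f^{(j)}(0)=0$ for $0\le j\le m$. Let $PW^s_a$ be the space of entire functions $f$ of exponential type $a$ (for every $\varepsilon>0$ there is $C_\varepsilon>0$ with $|f(z)|\le C_\varepsilon e^{(a+\varepsilon)|z|}$ for all $z\in\mathbb C$) whose restriction $f_0=f|_{\mathbb R}$ lies in $E^{s,2}$, with norm $\|f\|_{PW^s_a}=\|\Delta^{s/2}f_0\|_{L^2(\mathbb R)}$. **Statement.** $PW^s_a$ is a reproducing kernel Hilbert space of functions on $\mathbb C$. Its reproducing kernel $K$ (so $K(\cdot,z)\in PW^s_a$ and $f(z)=\langle f\,|\,K(\cdot,z)\rangle_{PW^s_a}$ for all $f\in PW^s_a$, $z\in\mathbb C$) is given, for all $w,z\in\mathbb C$, by the following absolutely convergent integrals: * if $0<s<\frac12$, $$K(w,z)=\frac1{2\pi}\int_{-a}^a e^{i(w-\bar z)\xi}\,|\xi|^{-2s}\,d\xi ;$$ * if $s>\frac12$,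 $$K(w,z)=\frac1{2\pi}\int_{-a}^a\big(e^{iw\xi}-P_m(iw\xi)\big)\big(e^{-i\bar z\xi}-P_m(-i\bar z\xi)\big)\,|\xi|^{-2s}\,d\xi ,\qquad P_m(\zeta)=\sum_{j=0}^m\frac{\zeta^j}{j!}.$$ -/

import Mathlib

open MeasureTheory Filter Topology SchwartzMap
open scoped ENNReal NNReal

noncomputable section

namespace FracPW

/-- The space of entire functions of exponential type `a`. -/
def ExpType (a : ℝ) : Set (ℂ → ℂ) :=
  {f | Differentiable ℂ f ∧
    ∀ ε : ℝ, 0 < ε → ∃ C : ℝ, 0 < C ∧ ∀ z : ℂ, ‖f z‖ ≤ C * Real.exp ((a + ε) * ‖z‖)}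

/-- The restriction `f₀` of a function on `ℂ` to the real line. -/
def restrictReal (f : ℂ → ℂ) : ℝ → ℂ := fun x => f (x : ℂ)

/-- The Fourier transform with the unitary normalisation
`f̂(ξ) = (2π)^{-1/2} ∫ f(x) e^{-ixξ} dx`. -/
def fourierT (f : ℝ → ℂ) : ℝ → ℂ := fun ξ =>
  ((Real.sqrt (2 * Real.pi) : ℝ) : ℂ)⁻¹ * ∫ x : ℝ, f x * Complex.exp (-(Complex.I * x * ξ))

/-- The inverse Fourier transform `(2π)^{-1/2} ∫ g(ξ) e^{ixξ} dξ`. -/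
def fourierInvT (g : ℝ → ℂ) : ℝ → ℂ := fun x =>
  ((Real.sqrt (2 * Real.pi) : ℝ) : ℂ)⁻¹ * ∫ ξ : ℝ, g ξ * Complex.exp (Complex.I * x * ξ)

/-- The fractional Laplacian `Δ^{s/2} φ = 𝓕⁻¹(|·|^s 𝓕 φ)` of a Schwartz function. -/
def fracLaplacianSchwartz (s : ℝ) (φ : 𝓢(ℝ, ℂ)) : ℝ → ℂ :=
  fourierInvT (fun ξ => ((|ξ| ^ s : ℝ) : ℂ) * fourierT φ ξ)

/-- The Schwartz functions whose moments of order `k ≤ m` vanish; all of `𝓢` when `m < 0`. -/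
def SchwartzVanishing (m : ℤ) : Set 𝓢(ℝ, ℂ) :=
  {ψ | ∀ k : ℕ, (k : ℤ) ≤ m → ∫ x : ℝ, (x : ℂ) ^ k * ψ x = 0}

/-- `φₙ → f` in the space of tempered distributions modulo polynomials of degree at most `m`:
convergence of the pairings with every Schwartz function whose moments up to order `m` vanish.
(There are no polynomials to divide out when `m < 0`.) -/
def TendstoModPoly (m : ℤ) (φ : ℕ → 𝓢(ℝ, ℂ)) (f : ℝ → ℂ) : Prop :=
  ∀ ψ ∈ SchwartzVanishing m,
    Tendsto (fun n => ∫ x : ℝ, φ n x * ψ x) atTop (𝓝 (∫ x : ℝ, f x * ψ x))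

/-- `h ∈ L²` is the fractional Laplacian `Δ^{s/2} f` of (the class of) `f` in the homogeneous
Sobolev space `Ẇ^{s,2}`: there are Schwartz functions `φₙ` with `φₙ → f` modulo polynomials of
degree at most `⌊s - 1/2⌋` and `Δ^{s/2} φₙ → h` in `L²`. In particular, `f` represents an element
of `Ẇ^{s,2}` if and only if such an `h` exists. -/
def HasFracLaplacian (s : ℝ) (f : ℝ → ℂ) (h : Lp ℂ 2 (volume : Measure ℝ)) : Prop :=
  ∃ φ : ℕ → 𝓢(ℝ, ℂ), TendstoModPoly ⌊s - 1 / 2⌋ φ f ∧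
    Tendsto (fun n => eLpNorm (fracLaplacianSchwartz s (φ n) - ⇑h) 2 volume) atTop (𝓝 0)

open Classical in
/-- The fractional Laplacian `Δ^{s/2} f ∈ L²`, set to be `0` if `f` is not in `Ẇ^{s,2}`. -/
def fracLaplacian (s : ℝ) (f : ℝ → ℂ) : Lp ℂ 2 (volume : Measure ℝ) :=
  if h : ∃ g, HasFracLaplacian s f g then h.choose else 0

/-- Membership in the homogeneous Lipschitz space of non-integer order `γ > 0`:
with `m = ⌊γ⌋`, `f` is of class `C^m` and `f^{(m)}` is Hölder continuous of order `γ - m`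
on the whole line. -/
def HomLipschitz (γ : ℝ) (f : ℝ → ℂ) : Prop :=
  ContDiff ℝ (⌊γ⌋₊ : ℕ) f ∧
    ∃ C : ℝ, ∀ x y : ℝ,
      ‖iteratedDeriv ⌊γ⌋₊ f x - iteratedDeriv ⌊γ⌋₊ f y‖ ≤ C * |x - y| ^ (γ - (⌊γ⌋₊ : ℝ))

/-- The Taylor polynomial of `f` of order `m` at the origin vanishes (no condition if `m < 0`). -/
def TaylorVanishes (m : ℤ) (f : ℝ → ℂ) : Prop :=
  ∀ j : ℕ, (j : ℤ) ≤ m → iteratedDeriv j f 0 = 0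

/-- The realization `E^{s,2}` of the homogeneous Sobolev space `Ẇ^{s,2}`, for `s > 0` with
`s - 1/2` not a nonnegative integer. For `s < 1/2` it lies in `L^{p*}`, `1/p* = 1/2 - s`;
for `s > 1/2` it lies in the homogeneous Lipschitz space of order `s - 1/2` and the Taylor
polynomials of order `⌊s - 1/2⌋` at `0` vanish. -/
def RealizationSpace (s : ℝ) : Set (ℝ → ℂ) :=
  {f | (s < 1 / 2 → MemLp f (ENNReal.ofReal (1 / (1 / 2 - s))) volume) ∧
    (1 / 2 < s → HomLipschitz (s - 1 / 2) f ∧ TaylorVanishes ⌊s - 1 / 2⌋ f) ∧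
    ∃ h, HasFracLaplacian s f h}

/-- The fractional Paley--Wiener space `PW^s_a`. -/
def PW (s a : ℝ) : Set (ℂ → ℂ) :=
  {f | f ∈ ExpType a ∧ restrictReal f ∈ RealizationSpace s ∧
    (1 / 2 ≤ s → TaylorVanishes ⌊s - 1 / 2⌋ (restrictReal f))}

/-- The norm `‖f‖ = ‖Δ^{s/2} f₀‖_{L²}` of `PW^s_a`. -/
def pwNorm (s : ℝ) (f : ℂ → ℂ) : ℝ := ‖fracLaplacian s (restrictReal f)‖

/-- The set `S` of complex functions on `X`, with pointwise operations and the norm `N`, is a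
reproducing kernel Hilbert space with kernel `K`: it is (the set of functions of) a complete
inner product space with norm `N` and continuous point evaluations, and `K(·, z)` is the element
representing the evaluation at `z`. -/
def IsRKHSWithKernel {X : Type} (S : Set (X → ℂ)) (N : (X → ℂ) → ℝ) (K : X → X → ℂ) : Prop :=
  ∃ (H : Type) (_ : NormedAddCommGroup H) (_ : InnerProductSpace ℂ H) (_ : CompleteSpace H)
    (_ : RKHS ℂ H X ℂ),
    Set.range (fun f : H => (f : X → ℂ)) = S ∧
    (∀ f : H, ‖f‖ = N f) ∧
    ∀ w z : X, RKHS.kernel H w z 1 = K w z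

/-- The Taylor polynomial `P_m(ζ) = ∑_{j ≤ m} ζ^j / j!` of the exponential function. -/
def expTaylor (m : ℕ) (ζ : ℂ) : ℂ := ∑ j ∈ Finset.range (m + 1), ζ ^ j / (j.factorial : ℂ)

/-- The integrand `e^{i(w - z̄)ξ} |ξ|^{-2s}`. -/
def kernelIntegrandSmall (s : ℝ) (w z : ℂ) (ξ : ℝ) : ℂ :=
  Complex.exp (Complex.I * (w - starRingEnd ℂ z) * ξ) * ((|ξ| ^ (-2 * s) : ℝ) : ℂ)

/-- The integrand `(e^{iwξ} - P_m(iwξ)) (e^{-iz̄ξ} - P_m(-iz̄ξ)) |ξ|^{-2s}`, `m = ⌊s - 1/2⌋`. -/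
def kernelIntegrandLarge (s : ℝ) (w z : ℂ) (ξ : ℝ) : ℂ :=
  (Complex.exp (Complex.I * w * ξ) - expTaylor ⌊s - 1 / 2⌋₊ (Complex.I * w * ξ)) *
    (Complex.exp (-(Complex.I * starRingEnd ℂ z * ξ)) -
      expTaylor ⌊s - 1 / 2⌋₊ (-(Complex.I * starRingEnd ℂ z * ξ))) *
    ((|ξ| ^ (-2 * s) : ℝ) : ℂ)

end FracPW

end

/-! Put `N = m + 1`, so that `N - 1/2 < s < N + 1/2`, and let `E_N` be the remainder of the
exponential series after `N` terms. The theorem follows from a parametrisation: `g ↦ F_g`, with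
`F_g(z) = (2π)^{-1/2} ∫ g(ξ) |ξ|^{-s} E_N(izξ) dξ`, maps `L²(-a, a)` isometrically onto `PW^s_a`.
Evaluation at `z` is then the inner product with an explicit element of `L²(-a, a)`
(`inner_evalVec`), and the kernel is the Gram function of these elements. Both cases are handled at
once, `N = 0` being `s < 1/2`.

The link between densities and classes modulo polynomials is duality. If the moments of `ψ` below
order `N` vanish, its Fourier transform vanishes to order `N` at `0`, so `|ξ|^{-s} ψ̂` is in `L²`
because `s < N + 1/2` (`memLp_abs_rpow_mul_fourierInvT`). Pairing `|ξ|^{-s} g` with `ψ̂` is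
therefore continuous in `g ∈ L²`, and Plancherel translates the existence of `Δ^{s/2} f` into the
existence of a unique density `g` with the norm of the fractional Laplacian
(`HasFracLaplacian.exists_density`, `exists_hasFracLaplacian`, `Order.density_unique`).

Each `F_g` lies in `PW^s_a` (`Order.bandFun_mem`): the type and the vanishing Taylor polynomial come
from `E_N`; the Hölder bound is Cauchy–Schwarz plus scaling (`homLipschitz_bandFun`); for `s < 1/2`
the `L^{p*}` bound is the Hardy–Littlewood–Sobolev embedding, proved by a weak-type estimate with a
cutoff depending on the level.

Conversely (`Order.exists_bandFun_of_mem`), let `g` be the density of `f ∈ PW^s_a`.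
Phragmén–Lindelöf and a contour shift show that `f` annihilates test functions whose spectrum lies
outside `[-a, a]`, so `g` is supported in `[-a, a]`. Now `f` and `F_g` agree modulo polynomials of
degree below `N` and both vanish to order `N` at `0`; hence they agree on `ℝ`, and on `ℂ` by the
identity theorem. -/

namespace FracPW

open FourierTransform
open scoped ContDiff

/-! ### The unitary Fourier transform -/

/-- The normalising constant `(2π)^{-1/2}`. -/
noncomputable def fc : ℂ := ((Real.sqrt (2 * Real.pi) : ℝ) : ℂ)⁻¹

lemma fc_ne_zero : fc ≠ 0 := by
  unfold fc
  have : 0 < Real.sqrt (2 * Real.pi) := Real.sqrt_pos.2 (by positivity)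
  exact inv_ne_zero (by exact_mod_cast this.ne')

lemma fc_mul_fc : fc * fc = (2 * Real.pi : ℂ)⁻¹ := by
  unfold fc
  rw [← mul_inv, ← Complex.ofReal_mul, Real.mul_self_sqrt (by positivity)]
  push_cast; rfl

lemma star_fc : starRingEnd ℂ fc = fc := by
  unfold fc; simp

lemma fourierInvT_eq (g : ℝ → ℂ) (x : ℝ) :
    fourierInvT g x = fc * 𝓕⁻ g (x / (2 * Real.pi)) := by
  unfold fourierInvT
  rw [Real.fourierInv_eq']
  congr 1
  refine integral_congr_ae (ae_of_all _ fun ξ => ?_)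
  simp only [smul_eq_mul]
  rw [mul_comm]
  congr 2
  simp only [RCLike.inner_apply, conj_trivial]
  push_cast
  have : (Real.pi : ℂ) ≠ 0 := by exact_mod_cast Real.pi_ne_zero
  field_simp

lemma fourierT_eq (g : ℝ → ℂ) (x : ℝ) :
    fourierT g x = fc * 𝓕 g (x / (2 * Real.pi)) := by
  unfold fourierT
  rw [Real.fourier_eq']
  congr 1
  refine integral_congr_ae (ae_of_all _ fun ξ => ?_)
  simp only [smul_eq_mul]
  rw [mul_comm]
  congr 2
  simp only [RCLike.inner_apply, conj_trivial]
  push_cast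
  have : (Real.pi : ℂ) ≠ 0 := by exact_mod_cast Real.pi_ne_zero
  field_simp

lemma fourierT_eq_fourierInvT_neg (g : ℝ → ℂ) (x : ℝ) : fourierT g x = fourierInvT g (-x) := by
  unfold fourierT fourierInvT
  congr 2
  funext ξ
  congr 2
  push_cast; ring

/-- The substitution `ξ = 2πη` reduces this to inversion for `𝓕`; its Jacobian `2π` cancels the two
factors `fc`. -/
lemma fourierInvT_fourierT_of (g : ℝ → ℂ) (hg : Continuous g) (hi : Integrable g)
    (hi' : Integrable (𝓕 g)) : fourierInvT (fourierT g) = g := by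
  funext x
  have h2 : (0:ℝ) < 2 * Real.pi := by positivity
  have h := hg.fourierInv_fourier_eq hi hi'
  have : (fun ξ => fourierT g ξ) = fun ξ => fc * 𝓕 g (ξ / (2 * Real.pi)) := by
    funext ξ; exact fourierT_eq g ξ
  change fourierInvT (fun ξ => fourierT g ξ) x = _
  rw [this]
  unfold fourierInvT
  have key : ∀ ξ : ℝ, fc * 𝓕 g (ξ / (2 * Real.pi)) * Complex.exp (Complex.I * x * ξ) =
      (fun η : ℝ => fc * 𝓕 g η * Complex.exp (Complex.I * x * (2 * Real.pi * η)))
        (ξ / (2 * Real.pi)) := by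
    intro ξ
    simp only
    congr 3
    push_cast
    have : (Real.pi : ℂ) ≠ 0 := by exact_mod_cast Real.pi_ne_zero
    field_simp
  rw [integral_congr_ae (ae_of_all _ key),
    Measure.integral_comp_div (fun η : ℝ => fc * 𝓕 g η *
      Complex.exp (Complex.I * x * (2 * Real.pi * η))) (2 * Real.pi), abs_of_pos h2]
  conv_rhs => rw [← h, Real.fourierInv_eq']
  have : ∀ η : ℝ, fc * 𝓕 g η * Complex.exp (Complex.I * x * (2 * Real.pi * η)) =
     fc * (Complex.exp (↑(2 * Real.pi * inner ℝ η x) * Complex.I) • 𝓕 g η) := by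
    intro η
    rw [smul_eq_mul, mul_assoc, mul_comm (𝓕 g η)]
    congr 3
    simp only [RCLike.inner_apply, conj_trivial]
    push_cast; ring
  simp_rw [this]
  rw [integral_const_mul, Complex.real_smul]
  change fc * _ = _
  generalize ∫ v : ℝ, Complex.exp (↑(2 * Real.pi * inner ℝ v x) * Complex.I) • 𝓕 g v = X
  have hpi : (Real.pi : ℂ) ≠ 0 := by exact_mod_cast Real.pi_ne_zero
  rw [show fc * (((2 * Real.pi : ℝ) : ℂ) * (fc * X)) = fc * fc * (2 * Real.pi) * X by
    push_cast; ring, fc_mul_fc, inv_mul_cancel₀ (by simp [hpi]), one_mul]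

lemma fourierT_fourierInvT_of (g : ℝ → ℂ) (hg : Continuous g) (hi : Integrable g)
    (hi' : Integrable (𝓕 g)) : fourierT (fourierInvT g) = g := by
  have h := fourierInvT_fourierT_of g hg hi hi'
  funext x
  conv_rhs => rw [← h]
  rw [fourierT_eq_fourierInvT_neg]
  unfold fourierInvT
  congr 1
  conv_rhs => rw [← integral_neg_eq_self]
  refine integral_congr_ae (ae_of_all _ fun ξ => ?_)
  simp only [fourierT_eq_fourierInvT_neg g, neg_neg]
  congr 2
  push_cast; ring

/-- Dilation by `(2π)⁻¹` as a continuous linear equivalence of `ℝ`. -/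
noncomputable def dilTwoPi : ℝ ≃L[ℝ] ℝ :=
  ContinuousLinearEquiv.unitsEquivAut ℝ (Units.mk0 (2 * Real.pi)⁻¹ (by positivity))

lemma dilTwoPi_apply (x : ℝ) : dilTwoPi x = x / (2 * Real.pi) := by
  simp [dilTwoPi, div_eq_mul_inv]

/-- The unitary Fourier transform of a Schwartz function as a Schwartz function. -/
noncomputable def ftS (φ : 𝓢(ℝ, ℂ)) : 𝓢(ℝ, ℂ) :=
  fc • SchwartzMap.compCLMOfContinuousLinearEquiv ℂ dilTwoPi (𝓕 φ)

/-- The unitary inverse Fourier transform of a Schwartz function as a Schwartz function. -/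
noncomputable def iftS (φ : 𝓢(ℝ, ℂ)) : 𝓢(ℝ, ℂ) :=
  fc • SchwartzMap.compCLMOfContinuousLinearEquiv ℂ dilTwoPi (𝓕⁻ φ)

lemma coe_ftS (φ : 𝓢(ℝ, ℂ)) : (ftS φ : ℝ → ℂ) = fourierT φ := by
  funext x
  rw [fourierT_eq]
  simp [ftS, dilTwoPi_apply, SchwartzMap.fourier_coe]

lemma coe_iftS (φ : 𝓢(ℝ, ℂ)) : (iftS φ : ℝ → ℂ) = fourierInvT φ := by
  funext x
  rw [fourierInvT_eq]
  simp [iftS, dilTwoPi_apply, SchwartzMap.fourierInv_coe]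

lemma fourierInvT_fourierT (φ : 𝓢(ℝ, ℂ)) : fourierInvT (fourierT φ) = φ :=
  fourierInvT_fourierT_of φ φ.continuous φ.integrable (by
    rw [← SchwartzMap.fourier_coe]; exact (𝓕 φ).integrable)

lemma fourierT_fourierInvT (φ : 𝓢(ℝ, ℂ)) : fourierT (fourierInvT φ) = φ :=
  fourierT_fourierInvT_of φ φ.continuous φ.integrable (by
    rw [← SchwartzMap.fourier_coe]; exact (𝓕 φ).integrable)

/-- Fubini: the kernel `e^{ixξ}` is symmetric in `x` and `ξ` and has modulus one. -/
lemma integral_fourierInvT_mul (u v : ℝ → ℂ) (hu : Integrable u) (hv : Integrable v) :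
    ∫ x, fourierInvT u x * v x = ∫ ξ, u ξ * fourierInvT v ξ := by
  unfold fourierInvT
  have hint : Integrable (Function.uncurry fun x ξ : ℝ =>
      u ξ * Complex.exp (Complex.I * x * ξ) * v x) (volume.prod volume) := by
    have h1 : Integrable (fun p : ℝ × ℝ => v p.1 * u p.2) (volume.prod volume) :=
      hv.mul_prod hu
    refine (h1.bdd_mul (c := 1) (f := fun p : ℝ × ℝ => Complex.exp (Complex.I * p.1 * p.2))
      (by fun_prop) (ae_of_all _ fun p => ?_)).congr (ae_of_all _ fun p => ?_)
    · rw [show Complex.I * p.1 * p.2 = ((p.1 * p.2 : ℝ) : ℂ) * Complex.I by push_cast; ring,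
        Complex.norm_exp_ofReal_mul_I]
    · simp only [Function.uncurry]; ring
  have e1 : ∀ x : ℝ, ((Real.sqrt (2 * Real.pi) : ℝ) : ℂ)⁻¹ *
      (∫ ξ : ℝ, u ξ * Complex.exp (Complex.I * x * ξ)) * v x =
      fc * ∫ ξ : ℝ, u ξ * Complex.exp (Complex.I * x * ξ) * v x := by
    intro x
    rw [integral_mul_const, ← mul_assoc]; rfl
  have e2 : ∀ ξ : ℝ, u ξ * (((Real.sqrt (2 * Real.pi) : ℝ) : ℂ)⁻¹ *
      (∫ x : ℝ, v x * Complex.exp (Complex.I * ξ * x))) =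
      fc * ∫ x : ℝ, u ξ * Complex.exp (Complex.I * x * ξ) * v x := by
    intro ξ
    rw [mul_left_comm, ← integral_const_mul]
    change fc * _ = _
    congr 1
    refine integral_congr_ae (ae_of_all _ fun x => ?_)
    simp only
    rw [show Complex.I * (ξ:ℂ) * x = Complex.I * x * ξ by ring]
    ring
  simp_rw [e1, e2, integral_const_mul]
  rw [integral_integral_swap hint]

lemma integral_mul_eq_fourier (φ ψ : 𝓢(ℝ, ℂ)) :
    ∫ x, φ x * ψ x = ∫ ξ, fourierT φ ξ * fourierInvT ψ ξ := by
  have h := integral_fourierInvT_mul (fourierT φ) ψ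
    (by rw [← coe_ftS]; exact (ftS φ).integrable) ψ.integrable
  rw [fourierInvT_fourierT] at h
  exact h

/-! ### Plancherel's theorem for the integral transform -/

lemma integral_fourierInv_mul (u v : ℝ → ℂ) (hu : Integrable u) (hv : Integrable v) :
    ∫ x, 𝓕⁻ u x * v x = ∫ ξ, u ξ * 𝓕⁻ v ξ := by
  have h := VectorFourier.integral_fourierIntegral_smul_eq_flip (L := -innerₗ ℝ) (μ := volume)
      (ν := volume) (f := u) (g := v) Real.continuous_fourierChar
      (by fun_prop) hu hv
  have hf : (-innerₗ ℝ).flip = -innerₗ ℝ := by ext; simp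
  rw [hf] at h
  exact h

lemma continuous_fourierInv_of_integrable {v : ℝ → ℂ} (hv : Integrable v) :
    Continuous (𝓕⁻ v) := by
  have h := VectorFourier.fourierIntegral_continuous (μ := volume) (L := innerₗ ℝ)
    Real.continuous_fourierChar continuous_inner hv
  have h' : Continuous (𝓕 v) := h
  have : 𝓕⁻ v = fun x => 𝓕 v (-x) := by
    funext x; exact Real.fourierInv_eq_fourier_neg v x
  rw [this]
  exact h'.comp continuous_neg

/-- The abstract `L²` transform and the integral define the same tempered distribution, and a
locally integrable function is determined by its pairings with smooth compactly supported functions.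
-/
lemma fourierInv_toLp_ae_eq {v : ℝ → ℂ} (hv : Integrable v) (hv2 : MemLp v 2) :
    (𝓕⁻ (hv2.toLp v) : Lp ℂ 2 (volume : Measure ℝ)) =ᵐ[volume] 𝓕⁻ v := by
  have h2 : (1:ℝ≥0∞) ≤ 2 := by norm_num
  refine ae_eq_of_integral_contDiff_smul_eq ((Lp.memLp _).locallyIntegrable h2)
    (continuous_fourierInv_of_integrable hv).locallyIntegrable ?_
  intro g hg hgs
  have hgs' : HasCompactSupport (fun x => (g x : ℂ)) := hgs.comp_left Complex.ofReal_zero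
  let ψ : 𝓢(ℝ, ℂ) := hgs'.toSchwartzMap (Complex.ofRealCLM.contDiff.comp hg)
  have hψ : ∀ x, ψ x = (g x : ℂ) := fun x => rfl
  have key := congrArg (fun T => T ψ) (Lp.fourierInv_toTemperedDistribution_eq (hv2.toLp v))
  simp only [Lp.toTemperedDistribution_apply] at key
  have e : (𝓕⁻ (Lp.toTemperedDistribution (hv2.toLp v))) ψ =
      (Lp.toTemperedDistribution (hv2.toLp v)) (𝓕⁻ ψ) := rfl
  rw [e, Lp.toTemperedDistribution_apply] at key
  calc ∫ x, g x • (𝓕⁻ (hv2.toLp v) : Lp ℂ 2 (volume : Measure ℝ)) x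
      = ∫ x, ψ x • (𝓕⁻ (hv2.toLp v) : Lp ℂ 2 (volume : Measure ℝ)) x := by
        simp [hψ]
    _ = ∫ x, (𝓕⁻ ψ) x • (hv2.toLp v) x := key.symm
    _ = ∫ x, v x * 𝓕⁻ (ψ : ℝ → ℂ) x := by
        refine integral_congr_ae ?_
        filter_upwards [hv2.coeFn_toLp] with x hx
        rw [hx, SchwartzMap.fourierInv_coe, smul_eq_mul, mul_comm]
    _ = ∫ x, 𝓕⁻ v x * ψ x := (integral_fourierInv_mul v ψ hv ψ.integrable).symm
    _ = ∫ x, g x • 𝓕⁻ v x := by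
        simp [hψ, mul_comm]

lemma eLpNorm_fourierInv {v : ℝ → ℂ} (hv : Integrable v) (hv2 : MemLp v 2) :
    eLpNorm (𝓕⁻ v) 2 volume = eLpNorm v 2 volume := by
  rw [← eLpNorm_congr_ae (fourierInv_toLp_ae_eq hv hv2), ← eLpNorm_congr_ae hv2.coeFn_toLp,
    ← ENNReal.toReal_eq_toReal_iff' (Lp.memLp _).2.ne (Lp.memLp _).2.ne, ← Lp.norm_def,
    ← Lp.norm_def]
  have := Lp.norm_fourier_eq (𝓕⁻ (hv2.toLp v))
  rw [fourier_fourierInv_eq] at this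
  exact this.symm

lemma continuous_fourierInvT {v : ℝ → ℂ} (hv : Integrable v) : Continuous (fourierInvT v) := by
  have : fourierInvT v = fun x => fc * 𝓕⁻ v (x / (2 * Real.pi)) := funext (fourierInvT_eq v)
  rw [this]
  have := continuous_fourierInv_of_integrable hv
  fun_prop

/-- Plancherel's theorem for `fourierInvT` on `L¹ ∩ L²`. -/
lemma eLpNorm_fourierInvT {v : ℝ → ℂ} (hv : Integrable v) (hv2 : MemLp v 2) :
    eLpNorm (fourierInvT v) 2 volume = eLpNorm v 2 volume := by
  have h2 : (0:ℝ) < 2 * Real.pi := by positivity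
  have e : fourierInvT v = fc • ((𝓕⁻ v) ∘ fun x => (2 * Real.pi)⁻¹ * x) := by
    funext x; rw [fourierInvT_eq]; simp [div_eq_inv_mul]
  rw [e, eLpNorm_const_smul, ← eLpNorm_map_measure
    (continuous_fourierInv_of_integrable hv).aestronglyMeasurable (by fun_prop),
    Real.map_volume_mul_left (by positivity), inv_inv, abs_of_pos h2,
    eLpNorm_smul_measure_of_ne_top (by norm_num), eLpNorm_fourierInv hv hv2, smul_eq_mul,
    ← mul_assoc]
  have : ‖fc‖ₑ * ENNReal.ofReal (2 * Real.pi) ^ (1 / (2 : ℝ≥0∞)).toReal = 1 := by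
    rw [← ofReal_norm, ENNReal.ofReal_rpow_of_nonneg h2.le (by positivity),
      ← ENNReal.ofReal_mul (norm_nonneg _)]
    unfold fc
    rw [norm_inv, Complex.norm_real, Real.norm_of_nonneg (Real.sqrt_nonneg _), Real.sqrt_eq_rpow]
    rw [show (1 / (2 : ℝ≥0∞)).toReal = 1 / 2 by simp]
    rw [inv_mul_cancel₀ (by positivity), ENNReal.ofReal_one]
  rw [this, one_mul]

lemma memLp_fourierInvT {v : ℝ → ℂ} (hv : Integrable v) (hv2 : MemLp v 2) :
    MemLp (fourierInvT v) 2 volume :=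
  ⟨(continuous_fourierInvT hv).aestronglyMeasurable, by
    rw [eLpNorm_fourierInvT hv hv2]; exact hv2.2⟩

lemma integrable_mul_exp {u : ℝ → ℂ} (hu : Integrable u) (x : ℝ) :
    Integrable (fun ξ : ℝ => u ξ * Complex.exp (Complex.I * x * ξ)) := by
  refine (hu.bdd_mul (c := 1) (f := fun ξ : ℝ => Complex.exp (Complex.I * x * ξ))
      (by fun_prop) (ae_of_all _ fun ξ => ?_)).congr (ae_of_all _ fun p => ?_)
  · rw [show Complex.I * x * ξ = ((x * ξ : ℝ) : ℂ) * Complex.I by push_cast; ring,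
        Complex.norm_exp_ofReal_mul_I]
  · simp only; ring

lemma fourierInvT_sub {u v : ℝ → ℂ} (hu : Integrable u) (hv : Integrable v) :
    fourierInvT (u - v) = fourierInvT u - fourierInvT v := by
  funext x
  simp only [fourierInvT, Pi.sub_apply, sub_mul]
  rw [integral_sub (integrable_mul_exp hu x) (integrable_mul_exp hv x), mul_sub]

/-! ### Remainders of the exponential series and test functions -/

/-- The remainder `E_N(w) = e^w - ∑_{j < N} w^j / j!` of the exponential series. -/
noncomputable def expRem (N : ℕ) (w : ℂ) : ℂ :=
  Complex.exp w - ∑ j ∈ Finset.range N, w ^ j / (j.factorial : ℂ)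

lemma expRem_zero (w : ℂ) : expRem 0 w = Complex.exp w := by simp [expRem]

lemma expRem_succ_zero (N : ℕ) : expRem (N + 1) 0 = 0 := by
  simp [expRem, Finset.sum_range_succ']

lemma norm_expRem_le (N : ℕ) (w : ℂ) : ‖expRem N w‖ ≤ ‖w‖ ^ N * Real.exp ‖w‖ :=
  Complex.norm_exp_sub_sum_le_norm_mul_exp w N

lemma star_expRem (N : ℕ) (w : ℂ) :
    starRingEnd ℂ (expRem N w) = expRem N (starRingEnd ℂ w) := by
  simp [expRem, Complex.exp_conj]

lemma hasDerivAt_expRem_succ (N : ℕ) (w : ℂ) : HasDerivAt (expRem (N + 1)) (expRem N w) w := by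
  unfold expRem
  refine (Complex.hasDerivAt_exp w).sub ?_
  simp_rw [Finset.sum_range_succ' _ N]
  simp only [pow_zero]
  refine HasDerivAt.add_const _ ?_
  refine HasDerivAt.fun_sum fun j _ => ?_
  have h := (hasDerivAt_pow (j + 1) w).div_const ((j + 1).factorial : ℂ)
  refine h.congr_deriv ?_
  rw [Nat.factorial_succ]
  have : (j.factorial : ℂ) ≠ 0 := by exact_mod_cast j.factorial_ne_zero
  have h2 : (j : ℂ) + 1 ≠ 0 := by exact_mod_cast j.succ_ne_zero
  push_cast
  field_simp

lemma hasDerivAt_expRem_zero (w : ℂ) : HasDerivAt (expRem 0) (expRem 0 w) w := by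
  have : expRem 0 = Complex.exp := funext expRem_zero
  rw [this]
  exact Complex.hasDerivAt_exp w

lemma differentiable_expRem (N : ℕ) : Differentiable ℂ (expRem N) := by
  intro w
  cases N with
  | zero => exact (hasDerivAt_expRem_zero w).differentiableAt
  | succ N => exact (hasDerivAt_expRem_succ N w).differentiableAt

lemma continuous_expRem (N : ℕ) : Continuous (expRem N) := (differentiable_expRem N).continuous

/-- On the imaginary axis `E_0` has modulus one, and integrating `E_{N+1}' = E_N` from `0` gains one
power each time. Unlike `norm_expRem_le` there is no exponential factor, so the bound can be paired
with Schwartz functions. -/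
lemma norm_expRem_I_mul_le (N : ℕ) (y : ℝ) : ‖expRem N (Complex.I * y)‖ ≤ |y| ^ N := by
  induction N generalizing y with
  | zero =>
    rw [expRem_zero, mul_comm, Complex.norm_exp_ofReal_mul_I]; simp
  | succ N ih =>
    have hd : ∀ t : ℝ, HasDerivAt (fun t : ℝ => expRem (N + 1) (Complex.I * t))
        (expRem N (Complex.I * t) * Complex.I) t := by
      intro t
      have h1 : HasDerivAt (fun t : ℝ => Complex.I * (t : ℂ)) Complex.I t := by
        simpa using (Complex.ofRealCLM.hasDerivAt (x := t)).const_mul Complex.I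
      exact (hasDerivAt_expRem_succ N (Complex.I * t)).comp t h1
    have key := (convex_uIcc (0:ℝ) y).norm_image_sub_le_of_norm_hasDerivWithin_le
      (f := fun t : ℝ => expRem (N + 1) (Complex.I * t)) (C := |y| ^ N)
      (fun t _ => (hd t).hasDerivWithinAt)
      (fun t ht => by
        rw [norm_mul, Complex.norm_I, mul_one]
        refine (ih t).trans (pow_le_pow_left₀ (abs_nonneg _) ?_ N)
        rcases le_total 0 y with h | h
        · rw [Set.uIcc_of_le h] at ht
          rw [abs_of_nonneg h, abs_of_nonneg ht.1]; exact ht.2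
        · rw [Set.uIcc_of_ge h] at ht
          rw [abs_of_nonpos h, abs_of_nonpos ht.2]; linarith [ht.1])
      Set.left_mem_uIcc Set.right_mem_uIcc
    simpa [expRem_succ_zero, pow_succ] using key

/-- Smooth functions with compact support in `ℝ ∖ {0}`. -/
def IsTest (v : ℝ → ℂ) : Prop := ContDiff ℝ ∞ v ∧ HasCompactSupport v ∧ (0 : ℝ) ∉ tsupport v

/-- The weight is smooth off the origin, where the test function lives; hence `|ξ|^{±s}` may be
moved freely onto test functions. -/
lemma IsTest.mul_abs_rpow {v : ℝ → ℂ} (hv : IsTest v) (p : ℝ) :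
    IsTest (fun ξ => ((|ξ| ^ p : ℝ) : ℂ) * v ξ) := by
  refine ⟨?_, hv.2.1.mul_left, fun h => hv.2.2 (tsupport_mul_subset_right h)⟩
  rw [contDiff_iff_contDiffAt]
  intro x
  by_cases hx : x = 0
  · subst hx
    have h0 : v =ᶠ[𝓝 0] 0 := notMem_tsupport_iff_eventuallyEq.1 hv.2.2
    refine (contDiffAt_const (c := (0:ℂ))).congr_of_eventuallyEq ?_
    filter_upwards [h0] with y hy
    simp [hy]
  · refine ContDiffAt.mul ?_ hv.1.contDiffAt
    refine Complex.ofRealCLM.contDiff.contDiffAt.comp x ?_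
    exact (contDiffAt_abs hx).rpow_const_of_ne (by simpa using hx)

/-- A test function as a Schwartz function. -/
noncomputable def IsTest.toSchwartz {v : ℝ → ℂ} (hv : IsTest v) : 𝓢(ℝ, ℂ) :=
  hv.2.1.toSchwartzMap hv.1

lemma IsTest.add {u v : ℝ → ℂ} (hu : IsTest u) (hv : IsTest v) : IsTest (u + v) :=
  ⟨hu.1.add hv.1, hu.2.1.add hv.2.1, fun h => by
    rcases tsupport_add u v h with h | h
    exacts [hu.2.2 h, hv.2.2 h]⟩

lemma IsTest.const_smul {v : ℝ → ℂ} (hv : IsTest v) (c : ℂ) : IsTest (c • v) :=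
  ⟨hv.1.const_smul c, hv.2.1.mono (Function.support_const_smul_subset c v),
    fun h => hv.2.2 (closure_mono (Function.support_const_smul_subset c v) h)⟩

lemma isTest_zero : IsTest 0 :=
  ⟨contDiff_const, HasCompactSupport.zero, by simp [tsupport]⟩

lemma fourierInvT_ftS (u : 𝓢(ℝ, ℂ)) : fourierInvT (ftS u) = u := by
  rw [coe_ftS, fourierInvT_fourierT]

/-- The moments of a Schwartz function are, up to constants, the derivatives of its Fourier
transform at `0`; here that transform is a reflected, rescaled multiple of `u`, which vanishes near
`0`. -/
lemma ftS_mem_schwartzVanishing (u : 𝓢(ℝ, ℂ)) (hu : (u : ℝ → ℂ) =ᶠ[𝓝 0] 0) (m : ℤ) :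
    ftS u ∈ SchwartzVanishing m := by
  intro k _
  set ψ := ftS u with hψ
  have hint : ∀ n : ℕ, Integrable (fun x : ℝ => x ^ n • ψ x) := by
    intro n
    have h := ψ.integrable_pow_mul volume n
    refine h.mono' ?_ (ae_of_all _ fun x => ?_)
    · exact ((continuous_id.pow n).smul ψ.continuous).aestronglyMeasurable
    · simp
  have hF := congrFun (Real.iteratedDeriv_fourier (f := ψ) (N := ⊤) (n := k)
    (fun n _ => hint n) le_top) 0
  have h2 : (0:ℝ) < 2 * Real.pi := by positivity
  have hz : (𝓕 (ψ : ℝ → ℂ)) =ᶠ[𝓝 0] fun _ => (0:ℂ) := by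
    have e : ∀ y : ℝ, 𝓕 (ψ : ℝ → ℂ) y = fc⁻¹ * u (-(2 * Real.pi * y)) := by
      intro y
      rw [← fourierInvT_ftS u, ← hψ, ← fourierT_eq_fourierInvT_neg, fourierT_eq,
        mul_div_cancel_left₀ _ h2.ne', ← mul_assoc, inv_mul_cancel₀ fc_ne_zero, one_mul]
    have ht : Tendsto (fun y : ℝ => -(2 * Real.pi * y)) (𝓝 0) (𝓝 0) := by
      have : Continuous (fun y : ℝ => -(2 * Real.pi * y)) := by fun_prop
      simpa using this.tendsto 0
    filter_upwards [ht.eventually hu] with y hy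
    rw [e, hy]; simp
  rw [hz.iteratedDeriv_eq k, Real.fourier_eq'] at hF
  have hF' : (0 : ℂ) = ∫ x : ℝ, (-2 * Real.pi * Complex.I) ^ k * ((x : ℂ) ^ k * ψ x) := by
    rw [show iteratedDeriv k (fun _ : ℝ => (0:ℂ)) 0 = 0 by
      rw [iteratedDeriv_const]; split_ifs <;> simp] at hF
    rw [hF]
    refine integral_congr_ae (ae_of_all _ fun x => ?_)
    simp only [inner_zero_right, mul_zero, Complex.ofReal_zero, zero_mul, Complex.exp_zero, one_mul,
      smul_eq_mul]
    rw [mul_pow (-2 * (Real.pi : ℂ) * Complex.I), mul_assoc]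
  rw [integral_const_mul] at hF'
  have hpi : (Real.pi : ℂ) ≠ 0 := by exact_mod_cast Real.pi_ne_zero
  have hne : (-2 * Real.pi * Complex.I : ℂ) ^ k ≠ 0 := pow_ne_zero _ (by simp [hpi])
  exact (mul_eq_zero.1 hF'.symm).resolve_left hne

lemma integrable_pow_mul_schwartz (ψ : 𝓢(ℝ, ℂ)) (n : ℕ) :
    Integrable (fun x : ℝ => (x : ℂ) ^ n * ψ x) := by
  refine (ψ.integrable_pow_mul volume n).mono' ?_ (ae_of_all _ fun x => ?_)
  · exact ((Complex.continuous_ofReal.pow n).mul ψ.continuous).aestronglyMeasurable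
  · simp

/-- The first `N` Taylor terms of `e^{ixξ}` integrate against `ψ` to multiples of its vanishing
moments, so they can be subtracted. -/
lemma fourierInvT_eq_expRem {N : ℕ} {ψ : 𝓢(ℝ, ℂ)} (hψ : ψ ∈ SchwartzVanishing ((N : ℤ) - 1))
    (ξ : ℝ) : fourierInvT ψ ξ = fc * ∫ x : ℝ, ψ x * expRem N (Complex.I * x * ξ) := by
  unfold fourierInvT
  change fc * _ = _
  congr 1
  have e : ∀ x : ℝ, ψ x * expRem N (Complex.I * x * ξ) =
      ψ x * Complex.exp (Complex.I * ξ * x) -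
      ∑ j ∈ Finset.range N, (Complex.I * ξ) ^ j / (j.factorial : ℂ) * ((x : ℂ) ^ j * ψ x) := by
    intro x
    rw [expRem, mul_sub, Finset.mul_sum]
    congr 1
    · congr 2; ring
    · refine Finset.sum_congr rfl fun j _ => ?_
      rw [show (Complex.I * (x:ℂ) * ξ) = (Complex.I * ξ) * x by ring, mul_pow]
      ring
  simp_rw [e]
  rw [integral_sub (integrable_mul_exp ψ.integrable ξ)
    (integrable_finsetSum _ fun j _ => (integrable_pow_mul_schwartz ψ j).const_mul _),
    integral_finsetSum _ fun j _ => (integrable_pow_mul_schwartz ψ j).const_mul _]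
  simp_rw [integral_const_mul]
  rw [Finset.sum_eq_zero, sub_zero]
  intro j hj
  rw [hψ j (by have := Finset.mem_range.1 hj; omega), mul_zero]

lemma norm_fourierInvT_le_of_vanishing {N : ℕ} {ψ : 𝓢(ℝ, ℂ)}
    (hψ : ψ ∈ SchwartzVanishing ((N : ℤ) - 1)) :
    ∃ C : ℝ, 0 ≤ C ∧ ∀ ξ : ℝ, ‖fourierInvT ψ ξ‖ ≤ C * |ξ| ^ N := by
  refine ⟨‖fc‖ * ∫ x : ℝ, ‖x‖ ^ N * ‖ψ x‖, by positivity, fun ξ => ?_⟩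
  rw [fourierInvT_eq_expRem hψ, norm_mul, mul_assoc]
  refine mul_le_mul_of_nonneg_left ?_ (norm_nonneg _)
  rw [← integral_mul_const]
  refine norm_integral_le_of_norm_le ((ψ.integrable_pow_mul volume N).mul_const _)
    (ae_of_all _ fun x => ?_)
  rw [norm_mul, show Complex.I * (x:ℂ) * ξ = Complex.I * ((x * ξ : ℝ) : ℂ) by push_cast; ring]
  calc ‖ψ x‖ * ‖expRem N (Complex.I * ((x * ξ : ℝ) : ℂ))‖ ≤ ‖ψ x‖ * |x * ξ| ^ N := by
        gcongr; exact norm_expRem_I_mul_le N _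
    _ = _ := by rw [abs_mul, mul_pow, Real.norm_eq_abs]; ring

/-! ### Square-integrability against the weight `|ξ|^{-s}` -/

lemma integrableOn_abs_rpow {p : ℝ} (hp : -1 < p) (r : ℝ) :
    IntegrableOn (fun ξ : ℝ => |ξ| ^ p) (Set.Icc (-r) r) := by
  have h : LocallyIntegrable (fun ξ : ℝ => |ξ| ^ p) volume := by
    refine locallyIntegrable_of_norm_le_rpow (C := 1) (α := -p) (by simp) (by simp; linarith)
      (ae_of_all _ fun x => ?_) (Measurable.aestronglyMeasurable (by fun_prop))
    simp [abs_of_nonneg (Real.rpow_nonneg (abs_nonneg x) p)]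
  exact h.integrableOn_isCompact isCompact_Icc

lemma memLp_two_of_sq {f : ℝ → ℂ} (hm : AEStronglyMeasurable f volume)
    (hi : Integrable (fun x => ‖f x‖ ^ 2)) : MemLp f 2 volume :=
  (memLp_two_iff_integrable_sq_norm hm).2 hi

/-- Near `0` the square is at most a multiple of `|ξ|^{2N-2s}`, integrable since `2N - 2s > -1`; for
`|ξ| > 1` the weight is at most `1` and the Schwartz decay suffices. -/
lemma memLp_abs_rpow_mul_fourierInvT {N : ℕ} {s : ℝ} (hs : 0 ≤ s) (hsN : s < N + 1 / 2)
    {ψ : 𝓢(ℝ, ℂ)} (hψ : ψ ∈ SchwartzVanishing ((N : ℤ) - 1)) :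
    MemLp (fun ξ : ℝ => ((|ξ| ^ (-s) : ℝ) : ℂ) * fourierInvT ψ ξ) 2 volume := by
  obtain ⟨C, hC0, hC⟩ := norm_fourierInvT_le_of_vanishing hψ
  have hmeas : AEStronglyMeasurable (fun ξ : ℝ => ((|ξ| ^ (-s) : ℝ) : ℂ) * fourierInvT ψ ξ)
      volume := by
    refine AEStronglyMeasurable.mul ?_ (continuous_fourierInvT ψ.integrable).aestronglyMeasurable
    exact (Complex.measurable_ofReal.comp (by fun_prop)).aestronglyMeasurable
  refine memLp_two_of_sq hmeas ?_
  have h1 : Integrable (fun ξ : ℝ => (Set.Icc (-1:ℝ) 1).indicator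
      (fun ξ => C ^ 2 * |ξ| ^ (2 * N - 2 * s)) ξ + ‖fourierInvT ψ ξ‖ ^ 2) := by
    refine Integrable.add ?_ ?_
    · exact IntegrableOn.integrable_indicator
        ((integrableOn_abs_rpow (by linarith) 1).const_mul _) measurableSet_Icc
    · have : MemLp (iftS ψ) 2 volume := (iftS ψ).memLp 2 volume
      rw [coe_iftS] at this
      exact (memLp_two_iff_integrable_sq_norm this.1).1 this
  refine h1.mono' (hmeas.norm.pow 2) (ae_of_all _ fun ξ => ?_)
  rw [Real.norm_of_nonneg (by positivity), norm_mul, Complex.norm_real,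
    Real.norm_of_nonneg (Real.rpow_nonneg (abs_nonneg _) _), mul_pow]
  by_cases hξ : ξ ∈ Set.Icc (-1:ℝ) 1
  · rw [Set.indicator_of_mem hξ]
    refine le_add_of_le_of_nonneg ?_ (by positivity)
    -- The origin is treated apart: there `0 ^ (-s)` is `0` for `s > 0` but `1` for `s = 0`.
    rcases eq_or_ne ξ 0 with rfl | h0
    · rcases hs.eq_or_lt with h | h
      · subst h
        rcases N.eq_zero_or_pos with hN | hN
        · subst hN
          have := hC 0
          simp only [pow_zero, mul_one] at this
          simp
          gcongr
        · have := hC 0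
          simp only [abs_zero, zero_pow hN.ne', mul_zero] at this
          have h00 : ‖fourierInvT ψ 0‖ = 0 := le_antisymm this (norm_nonneg _)
          rw [h00]; simp; positivity
      · rw [abs_zero, Real.zero_rpow (by linarith)]; simp; positivity
    · have hpos : 0 < |ξ| := abs_pos.2 h0
      calc (|ξ| ^ (-s)) ^ 2 * ‖fourierInvT ψ ξ‖ ^ 2 ≤ (|ξ| ^ (-s)) ^ 2 * (C * |ξ| ^ N) ^ 2 := by
            gcongr; exact hC ξ
        _ = C ^ 2 * |ξ| ^ (2 * N - 2 * s) := by
            rw [mul_pow, ← Real.rpow_natCast |ξ| N, ← Real.rpow_natCast (|ξ| ^ (-s)) 2,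
              ← Real.rpow_natCast (|ξ| ^ (N:ℝ)) 2, ← Real.rpow_mul hpos.le,
              ← Real.rpow_mul hpos.le, mul_left_comm, ← Real.rpow_add hpos]
            congr 2; push_cast; ring
  · rw [Set.indicator_of_notMem hξ, zero_add]
    have h1 : 1 ≤ |ξ| := by
      by_contra h
      rw [not_le, abs_lt] at h
      exact hξ ⟨h.1.le, h.2.le⟩
    have : |ξ| ^ (-s) ≤ 1 := Real.rpow_le_one_of_one_le_of_nonpos h1 (by linarith)
    have h3 : (|ξ| ^ (-s)) ^ 2 ≤ 1 := pow_le_one₀ (by positivity) this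
    nlinarith [sq_nonneg ‖fourierInvT ψ ξ‖]

/-! ### Density of test functions -/

lemma ae_eq_zero_of_integral_isTest {g : ℝ → ℂ} {U : Set ℝ} (hU : IsOpen U)
    (h0 : (0 : ℝ) ∉ U) (hg : LocallyIntegrable g volume)
    (h : ∀ v, IsTest v → tsupport v ⊆ U → ∫ ξ, g ξ * v ξ = 0) :
    ∀ᵐ ξ, ξ ∈ U → g ξ = 0 := by
  refine hU.ae_eq_zero_of_integral_contDiff_smul_eq_zero (hg.locallyIntegrableOn U) ?_
  intro η hη hηs hηU
  have hsub : tsupport (fun x => (η x : ℂ)) ⊆ tsupport η :=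
    closure_mono fun x hx => by
      simp only [Function.mem_support, ne_eq, Complex.ofReal_eq_zero] at hx
      exact hx
  have := h (fun x => (η x : ℂ)) ⟨Complex.ofRealCLM.contDiff.comp hη,
    hηs.comp_left Complex.ofReal_zero, fun h' => h0 (hηU (hsub h'))⟩ (hsub.trans hηU)
  rw [← this]
  refine integral_congr_ae (ae_of_all _ fun x => ?_)
  simp [mul_comm]

lemma IsTest.memLp {v : ℝ → ℂ} (hv : IsTest v) (p : ℝ≥0∞) : MemLp v p volume :=
  hv.1.continuous.memLp_of_hasCompactSupport hv.2.1

lemma IsTest.integrable {v : ℝ → ℂ} (hv : IsTest v) : Integrable v volume :=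
  hv.1.continuous.integrable_of_hasCompactSupport hv.2.1

/-- Test functions are dense in `L²`. -/
lemma exists_isTest_tendsto (g : Lp ℂ 2 (volume : Measure ℝ)) :
    ∃ v : ℕ → ℝ → ℂ, (∀ n, IsTest (v n)) ∧
      Tendsto (fun n => eLpNorm (v n - ⇑g) 2 volume) atTop (𝓝 0) := by
  let S : Submodule ℂ (Lp ℂ 2 (volume : Measure ℝ)) :=
    { carrier := {f | ∃ v : ℝ → ℂ, ∃ hv : IsTest v, f = (hv.memLp 2).toLp v}
      add_mem' := by
        rintro _ _ ⟨u, hu, rfl⟩ ⟨v, hv, rfl⟩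
        exact ⟨u + v, hu.add hv, (MemLp.toLp_add _ _).symm⟩
      zero_mem' := ⟨0, isTest_zero, (MemLp.toLp_zero _).symm⟩
      smul_mem' := by
        rintro c _ ⟨v, hv, rfl⟩
        exact ⟨c • v, hv.const_smul c, (MemLp.toLp_const_smul c _).symm⟩ }
  -- Density is equivalent to a trivial orthogonal complement: a function orthogonal to all test
  -- functions vanishes a.e. off `0`, and `{0}` is null.
  have hS : S.topologicalClosure = ⊤ := by
    rw [Submodule.topologicalClosure_eq_top_iff, Submodule.eq_bot_iff]
    intro f hf
    have h0 : ∀ᵐ ξ, ξ ∈ ({0}ᶜ : Set ℝ) → f ξ = 0 := by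
      refine ae_eq_zero_of_integral_isTest isOpen_compl_singleton (by simp)
        ((Lp.memLp f).locallyIntegrable (by norm_num)) ?_
      intro v hv _
      have hv' : IsTest (fun x => starRingEnd ℂ (v x)) :=
        ⟨Complex.conjCLE.contDiff.comp hv.1, hv.2.1.comp_left (map_zero _), fun h =>
          hv.2.2 (closure_mono (Function.support_comp_subset (map_zero (starRingEnd ℂ)) v) h)⟩
      have h := (Submodule.mem_orthogonal S f).1 hf _ ⟨_, hv', rfl⟩
      rw [L2.inner_def] at h
      rw [← h]
      refine integral_congr_ae ?_
      filter_upwards [(hv'.memLp 2).coeFn_toLp] with x hx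
      rw [hx]
      simp
    rw [Lp.eq_zero_iff_ae_eq_zero]
    have hne : ∀ᵐ ξ : ℝ, ξ ≠ 0 := by simp [ae_iff]
    filter_upwards [h0, hne] with ξ h1 h2
    exact h1 h2
  have hg : g ∈ closure (S : Set (Lp ℂ 2 (volume : Measure ℝ))) := by
    rw [← Submodule.topologicalClosure_coe, hS]; trivial
  obtain ⟨f, hfS, hf⟩ := mem_closure_iff_seq_limit.1 hg
  choose v hv hfv using hfS
  refine ⟨v, hv, ?_⟩
  have h1 := (tendsto_iff_edist_tendsto_0.1 hf)
  refine h1.congr fun n => ?_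
  rw [Lp.edist_def]
  refine eLpNorm_congr_ae ?_
  rw [hfv n]
  filter_upwards [((hv n).memLp 2).coeFn_toLp] with x hx
  simp [hx]

/-! ### Band-limited functions -/

/-- Densities supported in `[-a, a]` for which `∫ G(ξ) E_k(izξ) dξ` converges. -/
structure BandDensity (a : ℝ) (k : ℕ) (G : ℝ → ℂ) : Prop where
  meas : AEStronglyMeasurable G volume
  supp : ∀ ξ, ξ ∉ Set.Icc (-a) a → G ξ = 0
  int : Integrable (fun ξ => |ξ| ^ k * ‖G ξ‖)

/-- The function `z ↦ ∫ G(ξ) E_k(izξ) dξ`. -/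
noncomputable def bandInt (k : ℕ) (G : ℝ → ℂ) (z : ℂ) : ℂ :=
  ∫ ξ : ℝ, G ξ * expRem k (Complex.I * z * ξ)

namespace BandDensity

variable {a : ℝ} {k : ℕ} {G : ℝ → ℂ}

lemma norm_integrand_le (h : BandDensity a k G) {z : ℂ} {r : ℝ} (hz : ‖z‖ ≤ r) (ξ : ℝ) :
    ‖G ξ * expRem k (Complex.I * z * ξ)‖ ≤ |ξ| ^ k * ‖G ξ‖ * (r ^ k * Real.exp (a * r)) := by
  by_cases hξ : ξ ∈ Set.Icc (-a) a
  · have h1 : ‖Complex.I * z * ξ‖ = ‖z‖ * |ξ| := by simp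
    have hr : 0 ≤ r := (norm_nonneg z).trans hz
    have hξa : |ξ| ≤ a := abs_le.2 hξ
    rw [norm_mul]
    calc ‖G ξ‖ * ‖expRem k (Complex.I * z * ξ)‖
        ≤ ‖G ξ‖ * ((‖z‖ * |ξ|) ^ k * Real.exp (‖z‖ * |ξ|)) := by
          gcongr
          rw [← h1]; exact norm_expRem_le _ _
      _ ≤ ‖G ξ‖ * ((r * |ξ|) ^ k * Real.exp (r * a)) := by gcongr
      _ = _ := by rw [mul_pow, mul_comm r a]; ring
  · rw [h.supp ξ hξ]; simp

lemma integrable_integrand (h : BandDensity a k G) (z : ℂ) :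
    Integrable (fun ξ : ℝ => G ξ * expRem k (Complex.I * z * ξ)) := by
  refine (h.int.mul_const (‖z‖ ^ k * Real.exp (a * ‖z‖))).mono' ?_
    (ae_of_all _ fun ξ => h.norm_integrand_le le_rfl ξ)
  refine h.meas.mul (Continuous.aestronglyMeasurable ?_)
  exact (continuous_expRem k).comp (by fun_prop)

/-- Differentiating in `z` brings down `iξ` and lowers the index of the remainder. The truncated `k
- 1` is right at `k = 0`, because `E_0 = exp` is its own derivative and the factor `|ξ| ≤ a` is
harmless. -/
lemma pred (h : BandDensity a k G) : BandDensity a (k - 1) (fun ξ => Complex.I * ξ * G ξ) where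
  meas := by
    refine AEStronglyMeasurable.mul (Continuous.aestronglyMeasurable ?_) h.meas
    fun_prop
  supp ξ hξ := by rw [h.supp ξ hξ, mul_zero]
  int := by
    cases k with
    | zero =>
      refine (h.int.const_mul a).mono' ?_ (ae_of_all _ fun ξ => ?_)
      · refine AEStronglyMeasurable.mul (Continuous.aestronglyMeasurable (by fun_prop)) ?_
        refine AEStronglyMeasurable.norm ?_
        exact AEStronglyMeasurable.mul (Continuous.aestronglyMeasurable (by fun_prop)) h.meas
      · by_cases hξ : ξ ∈ Set.Icc (-a) a
        · have : |ξ| ≤ a := abs_le.2 hξ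
          simp
          gcongr
        · rw [h.supp ξ hξ]; simp
    | succ k =>
      refine h.int.congr (ae_of_all _ fun ξ => ?_)
      simp [pow_succ, mul_assoc]

lemma hasDerivAt_bandInt (h : BandDensity a k G) (z : ℂ) :
    HasDerivAt (bandInt k G) (bandInt (k - 1) (fun ξ => Complex.I * ξ * G ξ) z) z := by
  have h' := h.pred
  refine (hasDerivAt_integral_of_dominated_loc_of_deriv_le
    (F := fun z (ξ : ℝ) => G ξ * expRem k (Complex.I * z * ξ))
    (F' := fun z (ξ : ℝ) => Complex.I * ξ * G ξ * expRem (k - 1) (Complex.I * z * ξ))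
    (s := Metric.ball z 1) (Metric.ball_mem_nhds z one_pos)
    (bound := fun ξ => |ξ| ^ (k - 1) * ‖Complex.I * ξ * G ξ‖ *
      ((‖z‖ + 1) ^ (k - 1) * Real.exp (a * (‖z‖ + 1))))
    (Eventually.of_forall fun w => (h.integrable_integrand w).1) (h.integrable_integrand z)
    (h'.integrable_integrand z).1 (ae_of_all _ fun ξ w hw => ?_) (h'.int.mul_const _)
    (ae_of_all _ fun ξ w hw => ?_)).2
  · refine h'.norm_integrand_le ?_ ξ
    have h2 : ‖w - z‖ < 1 := by simpa [dist_eq_norm] using hw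
    have h3 : ‖w‖ ≤ ‖z‖ + ‖w - z‖ := by
      calc ‖w‖ = ‖z + (w - z)‖ := by ring_nf
        _ ≤ _ := norm_add_le _ _
    linarith
  · have hin : HasDerivAt (fun w : ℂ => Complex.I * w * ξ) (Complex.I * ξ) w := by
      simpa using ((hasDerivAt_id w).const_mul Complex.I).mul_const (ξ : ℂ)
    have hE : HasDerivAt (expRem k) (expRem (k - 1) (Complex.I * w * ξ)) (Complex.I * w * ξ) := by
      cases k with
      | zero => exact hasDerivAt_expRem_zero _
      | succ k => exact hasDerivAt_expRem_succ k _
    refine ((hE.comp w hin).const_mul (G ξ)).congr_deriv ?_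
    ring

lemma differentiable_bandInt (h : BandDensity a k G) : Differentiable ℂ (bandInt k G) :=
  fun z => (h.hasDerivAt_bandInt z).differentiableAt

lemma iterate (h : BandDensity a k G) (n : ℕ) :
    BandDensity a (k - n) (fun ξ => (Complex.I * ξ) ^ n * G ξ) := by
  induction n with
  | zero => simpa using h
  | succ n ih =>
    have := ih.pred
    rw [Nat.sub_sub] at this
    convert this using 2 with ξ
    ring

lemma iteratedDeriv_bandInt (h : BandDensity a k G) (n : ℕ) :
    iteratedDeriv n (fun x : ℝ => bandInt k G (x : ℂ)) =
      fun x : ℝ => bandInt (k - n) (fun ξ => (Complex.I * ξ) ^ n * G ξ) (x : ℂ) := by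
  induction n with
  | zero => simp
  | succ n ih =>
    rw [iteratedDeriv_succ, ih]
    funext x
    rw [((h.iterate n).hasDerivAt_bandInt (x : ℂ)).comp_ofReal.deriv, Nat.sub_sub]
    congr 1
    funext ξ
    ring

lemma norm_bandInt_le (h : BandDensity a k G) (z : ℂ) :
    ‖bandInt k G z‖ ≤ (∫ ξ, |ξ| ^ k * ‖G ξ‖) * (‖z‖ ^ k * Real.exp (a * ‖z‖)) := by
  rw [← integral_mul_const]
  exact norm_integral_le_of_norm_le (h.int.mul_const _)
    (ae_of_all _ fun ξ => h.norm_integrand_le le_rfl ξ)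

/-- The polynomial factor `‖z‖^k` is absorbed into `e^{ε‖z‖}` through one term of the exponential
series. -/
lemma bandInt_mem_expType (h : BandDensity a k G) : bandInt k G ∈ ExpType a := by
  refine ⟨h.differentiable_bandInt, fun ε hε => ?_⟩
  set A := ∫ ξ, |ξ| ^ k * ‖G ξ‖ with hA
  have hA0 : 0 ≤ A := integral_nonneg fun ξ => by positivity
  refine ⟨A * (k.factorial / ε ^ k) + 1, by positivity, fun z => (h.norm_bandInt_le z).trans ?_⟩
  have h1 : ‖z‖ ^ k ≤ k.factorial / ε ^ k * Real.exp (ε * ‖z‖) := by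
    have := Real.pow_div_factorial_le_exp (ε * ‖z‖) (by positivity) k
    rw [mul_pow, div_le_iff₀ (by positivity)] at this
    rw [div_mul_eq_mul_div, le_div_iff₀ (by positivity)]
    linarith
  calc A * (‖z‖ ^ k * Real.exp (a * ‖z‖))
      ≤ A * ((k.factorial / ε ^ k * Real.exp (ε * ‖z‖)) * Real.exp (a * ‖z‖)) := by gcongr
    _ = A * (k.factorial / ε ^ k) * Real.exp ((a + ε) * ‖z‖) := by
      rw [add_mul, Real.exp_add]; ring
    _ ≤ _ := by gcongr; linarith

/-- Fubini, after the vanishing moments of `ψ` have put the same remainder `E_k` into `fourierInvT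
ψ`; absolute convergence comes from `|E_k(ixξ)| ≤ |x|^k |ξ|^k`. -/
lemma integral_bandInt_mul (h : BandDensity a k G) {ψ : 𝓢(ℝ, ℂ)}
    (hψ : ψ ∈ SchwartzVanishing ((k : ℤ) - 1)) :
    ∫ x : ℝ, fc * bandInt k G x * ψ x = ∫ ξ, G ξ * fourierInvT ψ ξ := by
  have hint : Integrable (Function.uncurry fun x ξ : ℝ =>
      ψ x * (G ξ * expRem k (Complex.I * x * ξ))) (volume.prod volume) := by
    refine ((ψ.integrable_pow_mul volume k).mul_prod h.int).mono' ?_ (ae_of_all _ fun p => ?_)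
    · refine (ψ.continuous.aestronglyMeasurable.comp_fst).mul (h.meas.comp_snd.mul ?_)
      exact ((continuous_expRem k).comp (by fun_prop)).aestronglyMeasurable
    · obtain ⟨x, ξ⟩ := p
      simp only [Function.uncurry]
      rw [norm_mul, norm_mul,
        show Complex.I * (x:ℂ) * ξ = Complex.I * ((x * ξ : ℝ) : ℂ) by push_cast; ring]
      calc ‖ψ x‖ * (‖G ξ‖ * ‖expRem k (Complex.I * ((x * ξ : ℝ) : ℂ))‖)
          ≤ ‖ψ x‖ * (‖G ξ‖ * |x * ξ| ^ k) := by gcongr; exact norm_expRem_I_mul_le k _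
        _ = _ := by rw [abs_mul, mul_pow, Real.norm_eq_abs]; ring
  have e1 : ∀ x : ℝ, fc * bandInt k G x * ψ x =
      fc * ∫ ξ : ℝ, ψ x * (G ξ * expRem k (Complex.I * x * ξ)) := by
    intro x
    rw [integral_const_mul]; unfold bandInt; ring
  have e2 : ∀ ξ : ℝ, G ξ * fourierInvT ψ ξ =
      fc * ∫ x : ℝ, ψ x * (G ξ * expRem k (Complex.I * x * ξ)) := by
    intro ξ
    rw [fourierInvT_eq_expRem hψ, mul_left_comm, ← integral_const_mul]
    congr 1
    refine integral_congr_ae (ae_of_all _ fun x => ?_)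
    simp only; ring
  rw [integral_congr_ae (ae_of_all _ e1), integral_congr_ae (ae_of_all _ e2),
    integral_const_mul, integral_const_mul, integral_integral_swap hint]

end BandDensity

/-- The density `g(ξ) |ξ|^{-s}`. -/
noncomputable def wt (s : ℝ) (g : ℝ → ℂ) (ξ : ℝ) : ℂ := g ξ * ((|ξ| ^ (-s) : ℝ) : ℂ)

lemma ae_ne_zero : ∀ᵐ ξ : ℝ, ξ ≠ 0 := by simp [ae_iff]

lemma measurable_abs_rpow (p : ℝ) : Measurable fun ξ : ℝ => ((|ξ| ^ p : ℝ) : ℂ) :=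
  Complex.measurable_ofReal.comp (by fun_prop)

lemma memLp_indicator_pow_mul_rpow {N : ℕ} {s : ℝ} (hsN : s < N + 1 / 2) (a : ℝ) :
    MemLp ((Set.Icc (-a) a).indicator fun ξ : ℝ => |ξ| ^ N * |ξ| ^ (-s)) 2 volume := by
  have hm : AEStronglyMeasurable
      ((Set.Icc (-a) a).indicator fun ξ : ℝ => |ξ| ^ N * |ξ| ^ (-s)) volume :=
    AEStronglyMeasurable.indicator (Measurable.aestronglyMeasurable (by fun_prop))
      measurableSet_Icc
  rw [memLp_two_iff_integrable_sq hm]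
  have h1 := (integrableOn_abs_rpow (p := 2 * N - 2 * s) (by linarith) a).integrable_indicator
    measurableSet_Icc
  refine h1.congr ?_
  filter_upwards [ae_ne_zero] with ξ hξ
  by_cases h : ξ ∈ Set.Icc (-a) a
  · have hpos : 0 < |ξ| := abs_pos.2 hξ
    rw [Set.indicator_of_mem h, Set.indicator_of_mem h, ← Real.rpow_natCast |ξ| N,
      ← Real.rpow_add hpos, ← Real.rpow_natCast (|ξ| ^ _) 2, ← Real.rpow_mul hpos.le]
    congr 1; push_cast; ring
  · simp [h]

/-- Cauchy–Schwarz: `|ξ|^{N-s}` is square integrable on `[-a, a]` precisely because `s < N + 1/2`.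
-/
lemma bandDensity_wt {N : ℕ} {s a : ℝ} (hsN : s < N + 1 / 2) {g : ℝ → ℂ}
    (hg : MemLp g 2 volume) (hga : ∀ ξ, ξ ∉ Set.Icc (-a) a → g ξ = 0) :
    BandDensity a N (wt s g) where
  meas := hg.1.mul (measurable_abs_rpow _).aestronglyMeasurable
  supp ξ hξ := by simp [wt, hga ξ hξ]
  int := by
    refine ((memLp_indicator_pow_mul_rpow hsN a).integrable_mul hg.norm).congr
      (ae_of_all _ fun ξ => ?_)
    by_cases h : ξ ∈ Set.Icc (-a) a
    · simp [h, wt, abs_of_nonneg (Real.rpow_nonneg (abs_nonneg ξ) (-s))]; ring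
    · simp [h, wt, hga ξ h]

/-- The function `F_g(z) = (2π)^{-1/2} ∫ g(ξ) |ξ|^{-s} E_N(izξ) dξ`. -/
noncomputable def bandFun (N : ℕ) (s : ℝ) (g : ℝ → ℂ) (z : ℂ) : ℂ := fc * bandInt N (wt s g) z

lemma bandFun_mem_expType {N : ℕ} {s a : ℝ} (hsN : s < N + 1 / 2) {g : ℝ → ℂ}
    (hg : MemLp g 2 volume) (hga : ∀ ξ, ξ ∉ Set.Icc (-a) a → g ξ = 0) :
    bandFun N s g ∈ ExpType a := by
  obtain ⟨h1, h2⟩ := (bandDensity_wt hsN hg hga).bandInt_mem_expType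
  refine ⟨h1.const_mul fc, fun ε hε => ?_⟩
  obtain ⟨C, hC, hb⟩ := h2 ε hε
  have : 0 < ‖fc‖ := norm_pos_iff.2 fc_ne_zero
  refine ⟨‖fc‖ * C, by positivity, fun z => ?_⟩
  rw [bandFun, norm_mul, mul_assoc]
  exact mul_le_mul_of_nonneg_left (hb z) (norm_nonneg _)

lemma iteratedDeriv_bandFun {N : ℕ} {s a : ℝ} (hsN : s < N + 1 / 2) {g : ℝ → ℂ}
    (hg : MemLp g 2 volume) (hga : ∀ ξ, ξ ∉ Set.Icc (-a) a → g ξ = 0) (n : ℕ) :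
    iteratedDeriv n (restrictReal (bandFun N s g)) =
      fun x : ℝ => fc * bandInt (N - n) (fun ξ => (Complex.I * ξ) ^ n * wt s g ξ) x := by
  funext x
  rw [← congrFun ((bandDensity_wt hsN hg hga).iteratedDeriv_bandInt n) x]
  exact iteratedDeriv_const_mul_field fc _

/-- After `j < N` derivatives the remainder still has positive index, and `E_{k+1}(0) = 0`. -/
lemma taylorVanishes_bandFun {N : ℕ} {s a : ℝ} (hsN : s < N + 1 / 2) {g : ℝ → ℂ}
    (hg : MemLp g 2 volume) (hga : ∀ ξ, ξ ∉ Set.Icc (-a) a → g ξ = 0) :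
    TaylorVanishes ((N : ℤ) - 1) (restrictReal (bandFun N s g)) := by
  intro j hj
  rw [iteratedDeriv_bandFun hsN hg hga]
  obtain ⟨k, hk⟩ : ∃ k, N - j = k + 1 := ⟨N - j - 1, by omega⟩
  simp [bandInt, hk, expRem_succ_zero]

lemma integral_bandFun_mul {N : ℕ} {s a : ℝ} (hsN : s < N + 1 / 2) {g : ℝ → ℂ}
    (hg : MemLp g 2 volume) (hga : ∀ ξ, ξ ∉ Set.Icc (-a) a → g ξ = 0) {ψ : 𝓢(ℝ, ℂ)}
    (hψ : ψ ∈ SchwartzVanishing ((N : ℤ) - 1)) :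
    ∫ x : ℝ, restrictReal (bandFun N s g) x * ψ x = ∫ ξ, wt s g ξ * fourierInvT ψ ξ :=
  (bandDensity_wt hsN hg hga).integral_bandInt_mul hψ

lemma contDiff_restrictReal {f : ℂ → ℂ} (hf : Differentiable ℂ f) (n : WithTop ℕ∞) :
    ContDiff ℝ n (restrictReal f) :=
  (hf.contDiff.restrict_scalars ℝ).comp Complex.ofRealCLM.contDiff

/-! ### Hölder continuity -/

lemma integral_norm_mul_le_sqrt {f g : ℝ → ℝ} (hf : MemLp f 2 volume) (hg : MemLp g 2 volume) :
    ∫ x, ‖f x‖ * ‖g x‖ ≤ Real.sqrt (∫ x, f x ^ 2) * Real.sqrt (∫ x, g x ^ 2) := by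
  have h := integral_mul_norm_le_Lp_mul_Lq (μ := volume) (f := f) (g := g)
    Real.HolderConjugate.two_two (by simpa using hf) (by simpa using hg)
  simpa [Real.sqrt_eq_rpow] using h

/-- The comparison function `|ξ|^q min(2, |ξ|)²`. -/
noncomputable def holderWeight (q : ℝ) (ξ : ℝ) : ℝ := |ξ| ^ q * min 2 |ξ| ^ 2

/-- The weight is of size `|ξ|^{q+2}` at `0` and `|ξ|^q` at infinity, which is where the two bounds
on `q` enter. -/
lemma integrable_holderWeight {q : ℝ} (h3 : -3 < q) (h1 : q < -1) :
    Integrable (holderWeight q) := by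
  have hi1 := (integrableOn_abs_rpow (p := q + 2) (by linarith) 1).integrable_indicator
    measurableSet_Icc
  -- For `|ξ| ≥ 1` one has `|ξ| ≥ (1 + |ξ|)/2`, which costs `2^{-q}`; the `4` bounds `min(2, |ξ|)²`.
  have hi2 : Integrable (fun ξ : ℝ => 4 * 2 ^ (-q) * (1 + ‖ξ‖) ^ (- -q)) :=
    (integrable_one_add_norm (by simp; linarith)).const_mul _
  refine (hi1.add hi2).mono' (Measurable.aestronglyMeasurable (by unfold holderWeight; fun_prop)) ?_
  filter_upwards [ae_ne_zero] with ξ hξ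
  have hpos : 0 < |ξ| := abs_pos.2 hξ
  have hm : 0 ≤ min 2 |ξ| := by positivity
  unfold holderWeight
  rw [Real.norm_of_nonneg (by positivity), Pi.add_apply, neg_neg]
  by_cases h : ξ ∈ Set.Icc (-1:ℝ) 1
  · rw [Set.indicator_of_mem h]
    refine le_add_of_le_of_nonneg ?_ (by positivity)
    rw [Real.rpow_add hpos, Real.rpow_two]
    gcongr
    exact min_le_right _ _
  · rw [Set.indicator_of_notMem h, zero_add]
    have h1 : 1 ≤ |ξ| := by
      by_contra h'
      rw [not_le, abs_lt] at h'
      exact h ⟨h'.1.le, h'.2.le⟩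
    have h2 : |ξ| ^ q ≤ ((1 + |ξ|) / 2) ^ q :=
      Real.rpow_le_rpow_of_nonpos (by positivity) (by linarith) (by linarith)
    rw [Real.div_rpow (by positivity) (by norm_num), div_eq_mul_inv, ← Real.rpow_neg (by norm_num)]
      at h2
    have h4 : min 2 |ξ| ^ 2 ≤ 4 := by
      have : min 2 |ξ| ≤ 2 := min_le_left _ _
      nlinarith
    rw [Real.norm_eq_abs]
    calc |ξ| ^ q * min 2 |ξ| ^ 2 ≤ ((1 + |ξ|) ^ q * 2 ^ (-q)) * 4 := by gcongr
      _ = _ := by ring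

lemma norm_exp_I_sub_le (x y ξ : ℝ) :
    ‖Complex.exp (Complex.I * x * ξ) - Complex.exp (Complex.I * y * ξ)‖ ≤ min 2 (|(x - y) * ξ|) := by
  have e : ∀ x : ℝ, Complex.I * x * ξ = Complex.I * ((x * ξ : ℝ) : ℂ) := fun x => by
    push_cast; ring
  have n1 : ∀ t : ℝ, ‖Complex.exp (Complex.I * t)‖ = 1 := fun t => by
    rw [mul_comm, Complex.norm_exp_ofReal_mul_I]
  refine le_min ?_ ?_
  · refine (norm_sub_le _ _).trans ?_
    rw [e, e, n1, n1]; norm_num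
  · have h := norm_expRem_I_mul_le 1 ((x - y) * ξ)
    have h2 : Complex.exp (Complex.I * x * ξ) - Complex.exp (Complex.I * y * ξ) =
        Complex.exp (Complex.I * ((y * ξ : ℝ) : ℂ)) * expRem 1 (Complex.I * (((x - y) * ξ : ℝ) : ℂ)) := by
      simp only [expRem, Finset.range_one, Finset.sum_singleton, pow_zero, Nat.factorial_zero,
        Nat.cast_one, div_one]
      rw [mul_sub, ← Complex.exp_add, mul_one]
      congr 2 <;> (push_cast; ring)
    rw [h2, norm_mul, n1, one_mul]
    simpa using h

/-- After `m` derivatives the remainder is `E_1`, whose increments are those of `e^{ixξ}`, bounded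
by `min(2, |x - y||ξ|)`. Cauchy–Schwarz separates `‖g‖` from a weight integral, and dilating that
integral by `|x - y|` produces the Hölder exponent. -/
lemma homLipschitz_bandFun {m : ℕ} {s a : ℝ} (hsm : (m : ℝ) + 1 / 2 < s)
    (hsm' : s < m + 1 + 1 / 2) {g : ℝ → ℂ}
    (hg : MemLp g 2 volume) (hga : ∀ ξ, ξ ∉ Set.Icc (-a) a → g ξ = 0) :
    HomLipschitz (s - 1 / 2) (restrictReal (bandFun (m + 1) s g)) := by
  have hfl : ⌊s - 1 / 2⌋₊ = m := by
    rw [Nat.floor_eq_iff (by linarith [(Nat.cast_nonneg m : (0:ℝ) ≤ m)])]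
    constructor <;> linarith
  have hsN : s < ((m + 1 : ℕ) : ℝ) + 1 / 2 := by push_cast; linarith
  have hB := bandDensity_wt hsN hg hga
  refine ⟨contDiff_restrictReal (bandFun_mem_expType hsN hg hga).1 _, ?_⟩
  rw [hfl, iteratedDeriv_bandFun hsN hg hga]
  set q : ℝ := 2 * m - 2 * s with hq
  have hW := integrable_holderWeight (q := q) (by linarith) (by linarith)
  have hW0 : 0 ≤ ∫ ξ, holderWeight q ξ := integral_nonneg fun ξ => by
    unfold holderWeight; positivity
  refine ⟨‖fc‖ * (Real.sqrt (∫ ξ, ‖g ξ‖ ^ 2) * Real.sqrt (∫ ξ, holderWeight q ξ)),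
    fun x y => ?_⟩
  rcases eq_or_ne x y with rfl | hxy
  · simp only [sub_self, norm_zero]; positivity
  set t := |x - y| with ht
  have ht0 : 0 < t := abs_pos.2 (sub_ne_zero.2 hxy)
  have hB' := hB.iterate m
  rw [Nat.add_sub_cancel_left] at hB'
  rw [← mul_sub, norm_mul, mul_assoc, Nat.add_sub_cancel_left]
  refine mul_le_mul_of_nonneg_left ?_ (norm_nonneg _)
  unfold bandInt
  rw [← integral_sub (hB'.integrable_integrand x) (hB'.integrable_integrand y)]
  -- the weight of the increment
  let k : ℝ → ℝ := fun ξ => |ξ| ^ ((m : ℝ) - s) * min 2 (t * |ξ|)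
  -- `k²` is a dilate of `holderWeight q`; integrating it gives the power `t^{-q-1} =
  -- (t^{s-1/2-m})²`.
  have hk2 : ∀ᵐ ξ : ℝ, k ξ ^ 2 = t ^ (-q) * holderWeight q (t * ξ) := by
    filter_upwards [ae_ne_zero] with ξ hξ
    have hpos : 0 < |ξ| := abs_pos.2 hξ
    simp only [k, holderWeight]
    rw [mul_pow, abs_mul, abs_of_pos ht0, Real.mul_rpow ht0.le hpos.le, ← mul_assoc, ← mul_assoc,
      ← Real.rpow_add ht0, neg_add_cancel, Real.rpow_zero, one_mul, ← Real.rpow_natCast (|ξ| ^ _) 2,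
      ← Real.rpow_mul hpos.le]
    congr 2; push_cast; ring
  have hkm : Measurable k := by
    simp only [k]; fun_prop
  have hWt : Integrable (fun ξ => t ^ (-q) * holderWeight q (t * ξ)) :=
    (hW.comp_mul_left' ht0.ne').const_mul _
  have hkL : MemLp k 2 volume := by
    rw [memLp_two_iff_integrable_sq hkm.aestronglyMeasurable]
    exact hWt.congr (hk2.mono fun ξ h => h.symm)
  have hkI : ∫ ξ, k ξ ^ 2 = (t ^ (s - 1 / 2 - m)) ^ 2 * ∫ ξ, holderWeight q ξ := by
    rw [integral_congr_ae hk2, integral_const_mul, Measure.integral_comp_mul_left, smul_eq_mul,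
      ← mul_assoc]
    congr 1
    rw [abs_of_pos (inv_pos.2 ht0), ← Real.rpow_neg_one t, ← Real.rpow_add ht0,
      ← Real.rpow_natCast (t ^ _) 2, ← Real.rpow_mul ht0.le]
    congr 1; push_cast; ring
  have hCS := integral_norm_mul_le_sqrt hg.norm hkL
  rw [hkI, Real.sqrt_mul (by positivity), Real.sqrt_sq (by positivity)] at hCS
  calc _ ≤ ∫ ξ, ‖‖g ξ‖‖ * ‖k ξ‖ := by
        refine norm_integral_le_of_norm_le (hg.norm.norm.integrable_mul hkL.norm) ?_
        filter_upwards [ae_ne_zero] with ξ hξ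
        have hpos : 0 < |ξ| := abs_pos.2 hξ
        have he : ∀ x : ℝ, expRem 1 (Complex.I * x * ξ) = Complex.exp (Complex.I * x * ξ) - 1 := by
          intro x; simp [expRem]
        rw [he, he, ← mul_sub, sub_sub_sub_cancel_right, norm_mul]
        have h1 : ‖(Complex.I * (ξ : ℂ)) ^ m * wt s g ξ‖ = ‖g ξ‖ * |ξ| ^ ((m : ℝ) - s) := by
          simp only [wt, norm_mul, norm_pow, Complex.norm_I, Complex.norm_real, Real.norm_eq_abs,
            one_mul, abs_of_nonneg (Real.rpow_nonneg (abs_nonneg ξ) (-s))]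
          rw [sub_eq_add_neg, Real.rpow_add hpos, Real.rpow_natCast]; ring
        have h2 := norm_exp_I_sub_le x y ξ
        rw [abs_mul] at h2
        have hk0 : 0 ≤ k ξ := by simp only [k]; positivity
        rw [h1, norm_norm, Real.norm_of_nonneg hk0]
        simp only [k]
        rw [← mul_assoc]
        gcongr
    _ ≤ _ := hCS
    _ = _ := by ring

/-! ### The Hardy--Littlewood--Sobolev embedding -/

lemma norm_fourierInvT_le (u : ℝ → ℂ) (x : ℝ) : ‖fourierInvT u x‖ ≤ ‖fc‖ * ∫ ξ, ‖u ξ‖ := by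
  unfold fourierInvT
  rw [norm_mul]
  refine mul_le_mul_of_nonneg_left ((norm_integral_le_integral_norm _).trans (le_of_eq ?_))
    (norm_nonneg _)
  refine integral_congr_ae (ae_of_all _ fun ξ => ?_)
  simp only [norm_mul]
  rw [show Complex.I * x * ξ = ((x * ξ : ℝ) : ℂ) * Complex.I by push_cast; ring,
    Complex.norm_exp_ofReal_mul_I, mul_one]

lemma restrictReal_bandFun_zero (s : ℝ) (g : ℝ → ℂ) :
    restrictReal (bandFun 0 s g) = fourierInvT (wt s g) := by
  funext x
  simp only [restrictReal, bandFun, bandInt, expRem_zero]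
  rfl

lemma integral_sq_indicator_rpow (s : ℝ) {A : ℝ} (hA : 0 < A) :
    ∫ ξ : ℝ, ((Set.Icc (-A) A).indicator (fun ξ : ℝ => |ξ| ^ (-s)) ξ) ^ 2 =
      A ^ (1 - 2 * s) * ∫ ξ : ℝ, ((Set.Icc (-1) 1).indicator (fun ξ : ℝ => |ξ| ^ (-s)) ξ) ^ 2 := by
  have e : ∀ ξ : ℝ, ((Set.Icc (-A) A).indicator (fun ξ : ℝ => |ξ| ^ (-s)) ξ) ^ 2 =
      A ^ (-(2 * s)) *
        (fun η : ℝ => ((Set.Icc (-1) 1).indicator (fun ξ : ℝ => |ξ| ^ (-s)) η) ^ 2) (ξ / A) := by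
    intro ξ
    have hiff : ξ / A ∈ Set.Icc (-1 : ℝ) 1 ↔ ξ ∈ Set.Icc (-A) A := by
      rw [Set.mem_Icc, Set.mem_Icc, le_div_iff₀ hA, div_le_iff₀ hA]; simp
    by_cases h : ξ ∈ Set.Icc (-A) A
    · simp only [Set.indicator_of_mem h, Set.indicator_of_mem (hiff.2 h)]
      rw [abs_div, abs_of_pos hA, Real.div_rpow (abs_nonneg _) hA.le, div_pow,
        ← Real.rpow_natCast (A ^ (-s)) 2, ← Real.rpow_mul hA.le]
      have : (0:ℝ) < A ^ (-(2 * s)) := Real.rpow_pos_of_pos hA _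
      rw [show -s * ((2:ℕ):ℝ) = -(2 * s) by push_cast; ring]
      field_simp
    · simp only [Set.indicator_of_notMem h, Set.indicator_of_notMem (fun h' => h (hiff.1 h'))]
      simp
  rw [integral_congr_ae (ae_of_all _ e), integral_const_mul, Measure.integral_comp_div
    (fun η : ℝ => ((Set.Icc (-1) 1).indicator (fun ξ : ℝ => |ξ| ^ (-s)) η) ^ 2) A, smul_eq_mul, ← mul_assoc, abs_of_pos hA]
  congr 1
  nth_rewrite 2 [← Real.rpow_one A]
  rw [← Real.rpow_add hA]
  congr 1; ring

lemma lintegral_sq_eq {f : ℝ → ℂ} : ∫⁻ x, ‖f x‖ₑ ^ 2 = eLpNorm f 2 volume ^ 2 := by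
  have := eLpNorm_nnreal_pow_eq_lintegral (f := f) (μ := volume) (p := 2) (by norm_num)
  simpa using this.symm

/-- Weak-type estimate: at height `t`, only the frequencies with `t < 2M|ξ|^{1/2-s}` matter. -/
lemma meas_fourierInvT_gt_le {s : ℝ} (hs : 0 < s) (hs2 : s < 1 / 2) {g : ℝ → ℂ}
    (hg : MemLp g 2 volume) (hG : Integrable (wt s g)) :
    ∃ M : ℝ, 0 < M ∧ ∀ t : ℝ, 0 < t →
      volume {x | t < ‖fourierInvT (wt s g) x‖} ≤ ENNReal.ofReal (4 / t ^ 2) *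
        ∫⁻ ξ, {ξ : ℝ | t < 2 * M * |ξ| ^ (1 / 2 - s)}.indicator (fun ξ => ‖wt s g ξ‖ₑ ^ 2) ξ := by
  set I := ∫ ξ : ℝ, ((Set.Icc (-1) 1).indicator (fun ξ : ℝ => |ξ| ^ (-s)) ξ) ^ 2 with hI
  have hI0 : 0 ≤ I := integral_nonneg fun ξ => by positivity
  -- The summand `1` keeps `M` positive even when `g` vanishes.
  set M := ‖fc‖ * (Real.sqrt (∫ ξ, ‖g ξ‖ ^ 2) * Real.sqrt I) + 1 with hM
  have hM0 : 0 < M := by positivity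
  refine ⟨M, hM0, fun t ht => ?_⟩
  have hγ : 0 < 1 / 2 - s := by linarith
  set S : Set ℝ := {ξ : ℝ | t < 2 * M * |ξ| ^ (1 / 2 - s)} with hS
  have hSm : MeasurableSet S := measurableSet_lt measurable_const (by fun_prop)
  -- `A` solves `2M A^{1/2-s} = t`: by Cauchy–Schwarz the frequencies `|ξ| ≤ A` contribute at most
  -- `M A^{1/2-s} = t/2` pointwise.
  set A := (t / (2 * M)) ^ (1 / (1 / 2 - s)) with hA
  have hA0 : 0 < A := by positivity
  have hAp : A ^ (1 / 2 - s) = t / (2 * M) := by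
    rw [hA, ← Real.rpow_mul (by positivity), one_div_mul_cancel hγ.ne', Real.rpow_one]
  have hSA : ∀ ξ, ξ ∈ S ↔ A < |ξ| := by
    intro ξ
    rw [hS, Set.mem_ofPred_eq, ← Real.rpow_lt_rpow_iff hA0.le (abs_nonneg ξ) hγ, hAp,
      div_lt_iff₀ (by positivity), mul_comm]
  set G := wt s g with hGdef
  set Ghi := S.indicator G with hGhi
  set Glo := Sᶜ.indicator G with hGlo
  have hhi : Integrable Ghi := hG.indicator hSm
  have hlo : Integrable Glo := hG.indicator hSm.compl
  have hhi2 : MemLp Ghi 2 volume := by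
    refine (hg.const_mul ((A ^ (-s) : ℝ) : ℂ)).mono hhi.1 (ae_of_all _ fun ξ => ?_)
    by_cases h : ξ ∈ S
    · have h' := (hSA ξ).1 h
      rw [hGhi, Set.indicator_of_mem h, hGdef, wt, norm_mul, norm_mul, Complex.norm_real,
        Complex.norm_real, Real.norm_of_nonneg (by positivity), Real.norm_of_nonneg (by positivity),
        mul_comm]
      exact mul_le_mul_of_nonneg_right
        (Real.rpow_le_rpow_of_nonpos hA0 h'.le (neg_nonpos.2 hs.le)) (norm_nonneg _)
    · rw [hGhi, Set.indicator_of_notMem h, norm_zero]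
      exact norm_nonneg _
  have hlow : ∀ x, ‖fourierInvT Glo x‖ ≤ t / 2 := by
    intro x
    have hkL := memLp_indicator_pow_mul_rpow (N := 0) (s := s) (by simpa using hs2) A
    simp only [pow_zero, one_mul] at hkL
    have hCS := integral_norm_mul_le_sqrt hg.norm hkL
    rw [integral_sq_indicator_rpow s hA0, ← hI, Real.sqrt_mul (by positivity)] at hCS
    have hsq : Real.sqrt (A ^ (1 - 2 * s)) = t / (2 * M) := by
      rw [Real.sqrt_eq_rpow, ← Real.rpow_mul hA0.le, ← hAp]
      congr 1; ring
    rw [hsq] at hCS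
    calc ‖fourierInvT Glo x‖ ≤ ‖fc‖ * ∫ ξ, ‖Glo ξ‖ := norm_fourierInvT_le _ _
      _ ≤ ‖fc‖ * (Real.sqrt (∫ ξ, ‖g ξ‖ ^ 2) * (t / (2 * M) * Real.sqrt I)) := by
        gcongr
        refine le_trans (integral_mono hlo.norm (hg.norm.norm.integrable_mul hkL.norm)
          fun ξ => ?_) hCS
        by_cases h : ξ ∈ S
        · rw [hGlo, Set.indicator_of_notMem (by simpa using h)]; simp; positivity
        · have h' : ξ ∈ Set.Icc (-A) A := by
            rw [hSA, not_lt] at h; exact abs_le.1 h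
          rw [hGlo, Set.indicator_of_mem (by simpa using h)]
          simp only [Pi.mul_apply, Set.indicator_of_mem h', hGdef, wt, norm_mul, norm_norm,
            Complex.norm_real, le_refl]
      _ = (M - 1) * (t / (2 * M)) := by rw [hM]; ring
      _ ≤ M * (t / (2 * M)) := by gcongr; linarith
      _ = t / 2 := by field_simp
  have hsum : fourierInvT G = fourierInvT Ghi + fourierInvT Glo := by
    have h1 : Ghi = G - Glo := by
      rw [hGhi, hGlo, eq_sub_iff_add_eq, Set.indicator_self_add_compl]
    rw [h1, fourierInvT_sub hG hlo, sub_add_cancel]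
  -- Where the whole exceeds `t`, the high-frequency part is at least `t/2`; Chebyshev and
  -- Plancherel apply to that part.
  have hsub : {x | t < ‖fourierInvT G x‖} ⊆
      {x | ENNReal.ofReal (t / 2) ^ 2 ≤ ‖fourierInvT Ghi x‖ₑ ^ 2} := by
    intro x hx
    rw [Set.mem_ofPred_eq] at hx ⊢
    rw [hsum, Pi.add_apply] at hx
    have h1 := norm_add_le (fourierInvT Ghi x) (fourierInvT Glo x)
    have h2 := hlow x
    have h3 : t / 2 ≤ ‖fourierInvT Ghi x‖ := by linarith
    rw [← ofReal_norm]
    gcongr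
  refine (measure_mono hsub).trans ?_
  refine (meas_ge_le_lintegral_div ?_ ?_ ?_).trans ?_
  · exact ((continuous_fourierInvT hhi).measurable.enorm.pow_const 2).aemeasurable
  · have : ENNReal.ofReal (t / 2) ≠ 0 := by simpa using ht
    exact pow_ne_zero 2 this
  · exact ENNReal.pow_ne_top ENNReal.ofReal_ne_top
  · rw [lintegral_sq_eq, eLpNorm_fourierInvT hhi hhi2, ← lintegral_sq_eq, ENNReal.div_eq_inv_mul,
      ← ENNReal.ofReal_pow (by positivity), ← ENNReal.ofReal_inv_of_pos (by positivity)]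
    refine mul_le_mul' (le_of_eq ?_) (lintegral_mono fun ξ => le_of_eq ?_)
    · congr 1; field_simp; norm_num
    · by_cases h : ξ ∈ S
      · simp [hGhi, h]
      · simp [hGhi, h]

lemma lintegral_rpow_Ioo_le {r T : ℝ} (hr : -1 < r) (hT : 0 ≤ T) :
    ∫⁻ t in Set.Ioo 0 T, ENNReal.ofReal (t ^ r) = ENNReal.ofReal (T ^ (r + 1) / (r + 1)) := by
  have hint : IntegrableOn (fun t : ℝ => t ^ r) (Set.Ioo 0 T) := by
    have := intervalIntegral.intervalIntegrable_rpow' (a := 0) (b := T) hr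
    rw [intervalIntegrable_iff_integrableOn_Ioo_of_le hT] at this
    exact this
  rw [← ofReal_integral_eq_lintegral_ofReal hint]
  · rw [← integral_Ioc_eq_integral_Ioo, ← intervalIntegral.integral_of_le hT,
      integral_rpow (Or.inl hr), Real.zero_rpow (by linarith), sub_zero]
  · refine (ae_restrict_iff' measurableSet_Ioo).2 (ae_of_all _ fun t ht => ?_)
    exact Real.rpow_nonneg ht.1.le _

/-- The Hardy--Littlewood--Sobolev embedding: `|ξ|^{-s} g` with `g ∈ L²` is the Fourier transform
of a function in `L^{p*}`, `1/p* = 1/2 - s`. -/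
lemma memLp_fourierInvT_wt {s : ℝ} (hs : 0 < s) (hs2 : s < 1 / 2) {g : ℝ → ℂ}
    (hg : MemLp g 2 volume) (hG : Integrable (wt s g)) :
    MemLp (fourierInvT (wt s g)) (ENNReal.ofReal (1 / (1 / 2 - s))) volume := by
  set γ := 1 / 2 - s with hγ
  have hγ0 : 0 < γ := by linarith
  set p := 1 / γ with hp
  have hp0 : 0 < p := by positivity
  have hp2 : 2 < p := by
    rw [hp, lt_div_iff₀ hγ0]; linarith
  obtain ⟨M, hM, hlev⟩ := meas_fourierInvT_gt_le hs hs2 hg hG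
  set G := wt s g with hGdef
  have hcont := continuous_fourierInvT hG
  refine ⟨hcont.aestronglyMeasurable, ?_⟩
  rw [eLpNorm_lt_top_iff_lintegral_rpow_enorm_lt_top (by simpa using hp0) ENNReal.ofReal_ne_top,
    ENNReal.toReal_ofReal hp0.le]
  have e1 : ∫⁻ x, ‖fourierInvT G x‖ₑ ^ p = ∫⁻ x, ENNReal.ofReal (‖fourierInvT G x‖ ^ p) := by
    refine lintegral_congr fun x => ?_
    rw [← ENNReal.ofReal_rpow_of_nonneg (norm_nonneg _) hp0.le, ofReal_norm]
  rw [e1, lintegral_rpow_eq_lintegral_meas_lt_mul volume (ae_of_all _ fun x => norm_nonneg _)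
    hcont.norm.measurable.aemeasurable hp0]
  refine ENNReal.mul_lt_top ENNReal.ofReal_lt_top ?_
  -- The layer-cake integrand after inserting the weak-type bound: `4t^{-2} · t^{p-1} = 4t^{p-3}`.
  -- Since `p > 2` this is integrable at `t = 0`, so Tonelli allows integrating in `t` first.
  let K : ℝ → ℝ → ℝ≥0∞ := fun t ξ => {q : ℝ × ℝ | q.1 < 2 * M * |q.2| ^ γ}.indicator
    (fun q => ENNReal.ofReal (4 * q.1 ^ (p - 3)) * ‖G q.2‖ₑ ^ 2) (t, ξ)
  have hKset : MeasurableSet {q : ℝ × ℝ | q.1 < 2 * M * |q.2| ^ γ} :=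
    measurableSet_lt measurable_fst (by fun_prop)
  have hKm : AEMeasurable (Function.uncurry K)
      ((volume.restrict (Set.Ioi 0)).prod volume) := by
    refine AEMeasurable.indicator ?_ hKset
    have h1 : Measurable fun q : ℝ × ℝ => ENNReal.ofReal (4 * q.1 ^ (p - 3)) := by fun_prop
    refine h1.aemeasurable.mul ?_
    exact (hG.1.aemeasurable.comp_snd).enorm.pow_const 2
  have hle : ∫⁻ t in Set.Ioi (0:ℝ), volume {x | t < ‖fourierInvT G x‖} *
      ENNReal.ofReal (t ^ (p - 1)) ≤ ∫⁻ t in Set.Ioi (0:ℝ), ∫⁻ ξ, K t ξ := by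
    refine setLIntegral_mono_ae' measurableSet_Ioi (ae_of_all _ fun t ht => ?_)
    have ht0 : 0 < t := ht
    calc _ ≤ (ENNReal.ofReal (4 / t ^ 2) *
        ∫⁻ ξ, {ξ : ℝ | t < 2 * M * |ξ| ^ γ}.indicator (fun ξ => ‖G ξ‖ₑ ^ 2) ξ) *
          ENNReal.ofReal (t ^ (p - 1)) := by gcongr; exact hlev t ht0
      _ = ENNReal.ofReal (4 * t ^ (p - 3)) *
        ∫⁻ ξ, {ξ : ℝ | t < 2 * M * |ξ| ^ γ}.indicator (fun ξ => ‖G ξ‖ₑ ^ 2) ξ := by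
          rw [mul_right_comm, ← ENNReal.ofReal_mul (by positivity)]
          congr 2
          rw [show p - 1 = (p - 3) + 2 by ring, Real.rpow_add ht0, Real.rpow_two]
          field_simp
      _ = ∫⁻ ξ, K t ξ := by
          rw [← lintegral_const_mul' _ _ ENNReal.ofReal_ne_top]
          refine lintegral_congr fun ξ => ?_
          by_cases h : t < 2 * M * |ξ| ^ γ
          · simp [K, h]
          · simp [K, h]
  refine hle.trans_lt ?_
  rw [lintegral_lintegral_swap hKm]
  set C := 4 * ((2 * M) ^ (p - 2) / (p - 2)) with hC
  have hC0 : 0 ≤ C := by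
    have : 0 < p - 2 := by linarith
    positivity
  have hle2 : ∫⁻ ξ, ∫⁻ t in Set.Ioi (0:ℝ), K t ξ ≤ ∫⁻ ξ, ENNReal.ofReal C * ‖g ξ‖ₑ ^ 2 := by
    refine lintegral_mono_ae ?_
    filter_upwards [ae_ne_zero] with ξ hξ
    have hpos : 0 < |ξ| := abs_pos.2 hξ
    have hT0 : 0 ≤ 2 * M * |ξ| ^ γ := by positivity
    have e2 : ∀ t, K t ξ = (Set.Iio (2 * M * |ξ| ^ γ)).indicator
        (fun t => ENNReal.ofReal (t ^ (p - 3)) * (ENNReal.ofReal 4 * ‖G ξ‖ₑ ^ 2)) t := by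
      intro t
      by_cases h : t < 2 * M * |ξ| ^ γ
      · simp only [K, Set.mem_ofPred_eq, h, Set.indicator_of_mem, Set.mem_Iio]
        rw [ENNReal.ofReal_mul (by norm_num)]; ring
      · simp [K, h]
    have hc : ENNReal.ofReal 4 * ‖G ξ‖ₑ ^ 2 ≠ ⊤ := by finiteness
    rw [lintegral_congr e2, lintegral_indicator measurableSet_Iio,
      Measure.restrict_restrict measurableSet_Iio, Set.inter_comm, Set.Ioi_inter_Iio,
      lintegral_mul_const' _ _ hc, lintegral_rpow_Ioo_le (by linarith) hT0]
    have e3 : ‖G ξ‖ₑ ^ 2 = ENNReal.ofReal (|ξ| ^ (-(2 * s))) * ‖g ξ‖ₑ ^ 2 := by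
      rw [hGdef, wt, enorm_mul, mul_pow, mul_comm]
      congr 1
      rw [← ofReal_norm, Complex.norm_real, Real.norm_of_nonneg (by positivity),
        ← ENNReal.ofReal_pow (by positivity), ← Real.rpow_natCast, ← Real.rpow_mul hpos.le]
      congr 2; push_cast; ring
    rw [e3, ← mul_assoc, ← mul_assoc, ← ENNReal.ofReal_mul (by
      have : 0 < p - 3 + 1 := by linarith
      positivity), ← ENNReal.ofReal_mul (by
      have : 0 < p - 3 + 1 := by linarith
      positivity)]
    refine le_of_eq ?_
    congr 2
    rw [Real.mul_rpow (by positivity) (by positivity), ← Real.rpow_mul hpos.le,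
      show p - 3 + 1 = p - 2 by ring, hC]
    -- From `γp = 1` and `γ = 1/2 - s`; thus the `t`-integral yields `|ξ|^{2s}`, which cancels the
    -- weight in `‖G‖²`.
    have h1 : γ * (p - 2) = 2 * s := by
      rw [hp]; field_simp; rw [hγ]; ring
    rw [h1]
    have h2 : |ξ| ^ (2 * s) * |ξ| ^ (-(2 * s)) = 1 := by
      rw [← Real.rpow_add hpos, add_neg_cancel, Real.rpow_zero]
    calc _ = 4 * ((2 * M) ^ (p - 2) / (p - 2)) * (|ξ| ^ (2 * s) * |ξ| ^ (-(2 * s))) := by ring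
      _ = _ := by rw [h2, mul_one]
  refine hle2.trans_lt ?_
  rw [lintegral_const_mul' _ _ ENNReal.ofReal_ne_top]
  refine ENNReal.mul_lt_top ENNReal.ofReal_lt_top ?_
  rw [lintegral_sq_eq]
  exact ENNReal.pow_lt_top hg.2

lemma memLp_bandFun {s a : ℝ} (hs : 0 < s) (hs2 : s < 1 / 2) {g : ℝ → ℂ}
    (hg : MemLp g 2 volume) (hga : ∀ ξ, ξ ∉ Set.Icc (-a) a → g ξ = 0) :
    MemLp (restrictReal (bandFun 0 s g)) (ENNReal.ofReal (1 / (1 / 2 - s))) volume := by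
  rw [restrictReal_bandFun_zero]
  have h := bandDensity_wt (N := 0) (by simpa using hs2) hg hga
  refine memLp_fourierInvT_wt hs hs2 hg ?_
  refine (integrable_norm_iff h.meas).1 ?_
  simpa using h.int

/-! ### Fractional Laplacians and their densities -/

lemma tendsto_integral_mul_of_tendsto_eLpNorm {v : ℕ → ℝ → ℂ} {g k : ℝ → ℂ}
    (hv : ∀ n, MemLp (v n) 2 volume) (hg : MemLp g 2 volume) (hk : MemLp k 2 volume)
    (h : Tendsto (fun n => eLpNorm (v n - g) 2 volume) atTop (𝓝 0)) :
    Tendsto (fun n => ∫ ξ, v n ξ * k ξ) atTop (𝓝 (∫ ξ, g ξ * k ξ)) := by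
  refine tendsto_integral_of_L1' (fun ξ => g ξ * k ξ) (hg.integrable_mul hk).aestronglyMeasurable
    (Eventually.of_forall fun n => (hv n).integrable_mul hk) ?_
  have h2 : Tendsto (fun n => eLpNorm (v n - g) 2 volume * eLpNorm k 2 volume) atTop (𝓝 0) := by
    have := ENNReal.Tendsto.mul_const h (Or.inr hk.2.ne)
    simpa using this
  refine tendsto_of_tendsto_of_tendsto_of_le_of_le tendsto_const_nhds h2 (fun _ => zero_le) ?_
  intro n
  have e : ((fun ξ => v n ξ * k ξ) - fun ξ => g ξ * k ξ) = (v n - g) • k := by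
    funext ξ
    simp only [Pi.sub_apply, Pi.smul_apply', smul_eq_mul, sub_mul]
  have h3 : eLpNorm ((v n - g) • k) 1 volume ≤ eLpNorm (v n - g) 2 volume * eLpNorm k 2 volume :=
    eLpNorm_smul_le_mul_eLpNorm hk.1 ((hv n).sub hg).1
  rw [← e] at h3
  exact h3

lemma integrable_abs_rpow_mul_norm {p : ℝ} (hp : 0 ≤ p) (χ : 𝓢(ℝ, ℂ)) :
    Integrable (fun ξ : ℝ => |ξ| ^ p * ‖χ ξ‖) := by
  have h := (χ.integrable.norm).add (χ.integrable_pow_mul volume ⌈p⌉₊)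
  refine h.mono' ?_ (ae_of_all _ fun ξ => ?_)
  · exact (Measurable.aestronglyMeasurable (by fun_prop)).mul
      χ.continuous.norm.aestronglyMeasurable
  · rw [Real.norm_of_nonneg (by positivity), Pi.add_apply, ← one_add_mul]
    refine mul_le_mul_of_nonneg_right ?_ (norm_nonneg _)
    rcases le_total |ξ| 1 with h1 | h1
    · have := Real.rpow_le_one (abs_nonneg ξ) h1 hp
      have : 0 ≤ ‖ξ‖ ^ ⌈p⌉₊ := by positivity
      linarith
    · have := Real.rpow_le_rpow_of_exponent_le h1 (Nat.le_ceil p)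
      rw [Real.rpow_natCast] at this
      rw [Real.norm_eq_abs]; linarith

lemma aestronglyMeasurable_abs_rpow_mul (p : ℝ) (χ : 𝓢(ℝ, ℂ)) :
    AEStronglyMeasurable (fun ξ : ℝ => ((|ξ| ^ p : ℝ) : ℂ) * χ ξ) volume :=
  (measurable_abs_rpow p).aestronglyMeasurable.mul χ.continuous.aestronglyMeasurable

lemma integrable_abs_rpow_mul {p : ℝ} (hp : 0 ≤ p) (χ : 𝓢(ℝ, ℂ)) :
    Integrable (fun ξ : ℝ => ((|ξ| ^ p : ℝ) : ℂ) * χ ξ) := by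
  refine (integrable_abs_rpow_mul_norm hp χ).mono' (aestronglyMeasurable_abs_rpow_mul p χ)
    (ae_of_all _ fun ξ => ?_)
  rw [norm_mul, Complex.norm_real, Real.norm_of_nonneg (by positivity)]

lemma memLp_abs_rpow_mul {p : ℝ} (hp : 0 ≤ p) (χ : 𝓢(ℝ, ℂ)) :
    MemLp (fun ξ : ℝ => ((|ξ| ^ p : ℝ) : ℂ) * χ ξ) 2 volume := by
  refine memLp_two_of_sq (aestronglyMeasurable_abs_rpow_mul p χ) ?_
  obtain ⟨C, hC⟩ := χ.decay 0 0
  have hb : ∀ ξ, ‖χ ξ‖ ≤ C := fun ξ => by simpa using hC.2 ξ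
  refine ((integrable_abs_rpow_mul_norm (p := 2 * p) (by positivity) χ).const_mul C).mono'
    ((aestronglyMeasurable_abs_rpow_mul p χ).norm.pow 2) (ae_of_all _ fun ξ => ?_)
  rw [Real.norm_of_nonneg (by positivity), norm_mul, Complex.norm_real,
    Real.norm_of_nonneg (by positivity), mul_pow, mul_comm 2 p, Real.rpow_mul (abs_nonneg _),
    Real.rpow_two]
  have h0 := norm_nonneg (χ ξ)
  calc (|ξ| ^ p) ^ 2 * ‖χ ξ‖ ^ 2 = (|ξ| ^ p) ^ 2 * (‖χ ξ‖ * ‖χ ξ‖) := by ring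
    _ ≤ (|ξ| ^ p) ^ 2 * (C * ‖χ ξ‖) := by gcongr; exact hb ξ
    _ = _ := by ring

/-- Lets Cauchy sequences pass between the densities and the fractional Laplacians, in both
directions. -/
lemma dist_toLp_fourierInvT {v w : ℝ → ℂ} (hv : Integrable v) (hv2 : MemLp v 2 volume)
    (hw : Integrable w) (hw2 : MemLp w 2 volume) :
    dist ((memLp_fourierInvT hv hv2).toLp _) ((memLp_fourierInvT hw hw2).toLp _) =
      dist (hv2.toLp v) (hw2.toLp w) := by
  rw [Lp.dist_edist, Lp.dist_edist, Lp.edist_toLp_toLp, Lp.edist_toLp_toLp,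
    ← fourierInvT_sub hv hw, eLpNorm_fourierInvT (hv.sub hw) (hv2.sub hw2)]

lemma norm_toLp_fourierInvT {v : ℝ → ℂ} (hv : Integrable v) (hv2 : MemLp v 2 volume) :
    ‖(memLp_fourierInvT hv hv2).toLp _‖ = ‖hv2.toLp v‖ := by
  rw [Lp.norm_toLp, Lp.norm_toLp, eLpNorm_fourierInvT hv hv2]

lemma tendsto_toLp_iff {v : ℕ → ℝ → ℂ} (hv : ∀ n, MemLp (v n) 2 volume)
    (g : Lp ℂ 2 (volume : Measure ℝ)) :
    Tendsto (fun n => (hv n).toLp (v n)) atTop (𝓝 g) ↔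
      Tendsto (fun n => eLpNorm (v n - ⇑g) 2 volume) atTop (𝓝 0) := by
  rw [tendsto_iff_edist_tendsto_0]
  refine tendsto_congr fun n => ?_
  rw [Lp.edist_def]
  refine eLpNorm_congr_ae ?_
  filter_upwards [(hv n).coeFn_toLp] with x hx
  simp [hx]

lemma cauchySeq_of_dist_eq {α β : Type*} [PseudoMetricSpace α] [PseudoMetricSpace β]
    {u : ℕ → α} {v : ℕ → β} (h : ∀ m n, dist (u m) (u n) = dist (v m) (v n))
    (hv : CauchySeq v) : CauchySeq u := by
  rw [Metric.cauchySeq_iff] at hv ⊢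
  simpa only [h] using hv

lemma mul_abs_rpow_cancel {s : ℝ} {ξ : ℝ} (hξ : ξ ≠ 0) :
    ((|ξ| ^ s : ℝ) : ℂ) * ((|ξ| ^ (-s) : ℝ) : ℂ) = 1 := by
  rw [← Complex.ofReal_mul, ← Real.rpow_add (abs_pos.2 hξ), add_neg_cancel, Real.rpow_zero,
    Complex.ofReal_one]

/-- Every fractional Laplacian comes with a density `g ∈ L²` of the same norm such that `f` is, up
to polynomials, the inverse Fourier transform of `|ξ|^{-s} g`. -/
lemma HasFracLaplacian.exists_density {N : ℕ} {s : ℝ} (hs : 0 ≤ s) (hsN : s < N + 1 / 2)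
    (hfl : ⌊s - 1 / 2⌋ = (N : ℤ) - 1) {f : ℝ → ℂ} {h : Lp ℂ 2 (volume : Measure ℝ)}
    (hf : HasFracLaplacian s f h) :
    ∃ g : Lp ℂ 2 (volume : Measure ℝ), ‖g‖ = ‖h‖ ∧
      ∀ ψ ∈ SchwartzVanishing ((N : ℤ) - 1),
        ∫ x, f x * ψ x = ∫ ξ, wt s g ξ * fourierInvT ψ ξ := by
  obtain ⟨φ, hφ, hlim⟩ := hf
  rw [hfl] at hφ
  let v : ℕ → ℝ → ℂ := fun n ξ => ((|ξ| ^ s : ℝ) : ℂ) * fourierT (φ n) ξ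
  have hv1 : ∀ n, Integrable (v n) := fun n => by
    have := integrable_abs_rpow_mul hs (ftS (φ n))
    rwa [coe_ftS] at this
  have hv2 : ∀ n, MemLp (v n) 2 volume := fun n => by
    have := memLp_abs_rpow_mul hs (ftS (φ n))
    rwa [coe_ftS] at this
  have hD : Tendsto (fun n => (memLp_fourierInvT (hv1 n) (hv2 n)).toLp _) atTop (𝓝 h) :=
    (tendsto_toLp_iff _ h).2 hlim
  -- The densities `|ξ|^s φ̂ₙ` inherit the Cauchy property from `Δ^{s/2} φₙ` by Plancherel; their
  -- limit is the required `g`.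
  have hC : CauchySeq (fun n => (hv2 n).toLp (v n)) :=
    cauchySeq_of_dist_eq (fun m n => (dist_toLp_fourierInvT (hv1 m) (hv2 m) (hv1 n) (hv2 n)).symm)
      hD.cauchySeq
  obtain ⟨g, hg⟩ := cauchySeq_tendsto_of_complete hC
  refine ⟨g, ?_, fun ψ hψ => ?_⟩
  · refine tendsto_nhds_unique hg.norm ?_
    refine hD.norm.congr fun n => norm_toLp_fourierInvT (hv1 n) (hv2 n)
  · have hk := memLp_abs_rpow_mul_fourierInvT hs hsN hψ
    have h1 := tendsto_integral_mul_of_tendsto_eLpNorm hv2 (Lp.memLp g) hk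
      ((tendsto_toLp_iff hv2 g).1 hg)
    refine tendsto_nhds_unique (hφ ψ hψ) ?_
    have e : ∫ ξ, wt s g ξ * fourierInvT ψ ξ =
        ∫ ξ, g ξ * (((|ξ| ^ (-s) : ℝ) : ℂ) * fourierInvT ψ ξ) := by
      simp only [wt, mul_assoc]
    rw [e]
    refine h1.congr fun n => ?_
    rw [integral_mul_eq_fourier]
    refine integral_congr_ae ?_
    filter_upwards [ae_ne_zero] with ξ hξ
    have := mul_abs_rpow_cancel (s := s) hξ
    simp only [v]
    linear_combination (fourierT (φ n) ξ * fourierInvT ψ ξ) * this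

/-- A function which is, up to polynomials, the inverse Fourier transform of `|ξ|^{-s} g` with
`g ∈ L²` has a fractional Laplacian. -/
lemma exists_hasFracLaplacian {N : ℕ} {s : ℝ} (hs : 0 ≤ s) (hsN : s < N + 1 / 2)
    (hfl : ⌊s - 1 / 2⌋ = (N : ℤ) - 1) {f : ℝ → ℂ} (g : Lp ℂ 2 (volume : Measure ℝ))
    (hf : ∀ ψ ∈ SchwartzVanishing ((N : ℤ) - 1),
      ∫ x, f x * ψ x = ∫ ξ, wt s g ξ * fourierInvT ψ ξ) :
    ∃ h, HasFracLaplacian s f h := by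
  obtain ⟨v, hv, hlim⟩ := exists_isTest_tendsto g
  have hv1 : ∀ n, Integrable (v n) := fun n => (hv n).integrable
  have hv2 : ∀ n, MemLp (v n) 2 volume := fun n => (hv n).memLp 2
  have hg := (tendsto_toLp_iff hv2 g).2 hlim
  have hC : CauchySeq (fun n => (memLp_fourierInvT (hv1 n) (hv2 n)).toLp _) :=
    cauchySeq_of_dist_eq (fun m n => dist_toLp_fourierInvT (hv1 m) (hv2 m) (hv1 n) (hv2 n))
      hg.cauchySeq
  obtain ⟨h, hh⟩ := cauchySeq_tendsto_of_complete hC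
  let u : ℕ → 𝓢(ℝ, ℂ) := fun n => ((hv n).mul_abs_rpow (-s)).toSchwartz
  have hu : ∀ n ξ, u n ξ = ((|ξ| ^ (-s) : ℝ) : ℂ) * v n ξ := fun n ξ => rfl
  have hft : ∀ n, fourierT (iftS (u n)) = u n := fun n => by
    rw [coe_iftS, fourierT_fourierInvT]
  refine ⟨h, fun n => iftS (u n), ?_, ?_⟩
  · rw [hfl]
    intro ψ hψ
    rw [hf ψ hψ]
    have hk := memLp_abs_rpow_mul_fourierInvT hs hsN hψ
    have h1 := tendsto_integral_mul_of_tendsto_eLpNorm hv2 (Lp.memLp g) hk hlim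
    have e : ∫ ξ, wt s g ξ * fourierInvT ψ ξ =
        ∫ ξ, g ξ * (((|ξ| ^ (-s) : ℝ) : ℂ) * fourierInvT ψ ξ) := by
      simp only [wt, mul_assoc]
    rw [e]
    refine h1.congr fun n => ?_
    rw [integral_mul_eq_fourier, hft]
    refine integral_congr_ae (ae_of_all _ fun ξ => ?_)
    simp only [hu]; ring
  · refine ((tendsto_toLp_iff _ h).1 hh).congr fun n => ?_
    congr 2
    unfold fracLaplacianSchwartz
    congr 1
    funext ξ
    rw [hft, hu, ← mul_assoc]
    rcases eq_or_ne ξ 0 with rfl | hξ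
    -- At the origin the two powers need not cancel, but the test function vanishes there.
    · rw [image_eq_zero_of_notMem_tsupport (hv n).2.2, mul_zero]
    · rw [mul_abs_rpow_cancel hξ, one_mul]

/-- A density is determined by its integrals against test functions. -/
lemma ae_eq_zero_of_integral_wt {s : ℝ} {g : ℝ → ℂ} (hg : MemLp g 2 volume) {U : Set ℝ}
    (hU : IsOpen U) (h0 : (0 : ℝ) ∉ U)
    (h : ∀ u, IsTest u → tsupport u ⊆ U → ∫ ξ, wt s g ξ * u ξ = 0) :
    ∀ᵐ ξ, ξ ∈ U → g ξ = 0 := by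
  refine ae_eq_zero_of_integral_isTest hU h0 (hg.locallyIntegrable (by norm_num)) ?_
  intro v hv hvU
  rw [← h _ (hv.mul_abs_rpow s) (tsupport_mul_subset_right.trans hvU)]
  refine integral_congr_ae ?_
  filter_upwards [ae_ne_zero] with ξ hξ
  have := mul_abs_rpow_cancel (s := s) hξ
  simp only [wt]
  linear_combination (-g ξ * v ξ) * this

lemma IsTest.ftS_mem {u : ℝ → ℂ} (hu : IsTest u) (m : ℤ) :
    ftS hu.toSchwartz ∈ SchwartzVanishing m :=
  ftS_mem_schwartzVanishing _ (notMem_tsupport_iff_eventuallyEq.1 hu.2.2) m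

lemma IsTest.fourierInvT_ftS {u : ℝ → ℂ} (hu : IsTest u) :
    fourierInvT (ftS hu.toSchwartz) = u := by
  rw [FracPW.fourierInvT_ftS]; rfl

/-! ### Spectrum of functions of exponential type -/

/-- Polynomial growth on the real line. -/
def PolyGrowth (f : ℝ → ℂ) : Prop :=
  ∃ C : ℝ, ∃ M : ℕ, 0 ≤ C ∧ ∀ x : ℝ, ‖f x‖ ≤ C * (1 + |x|) ^ M

/-- A function of exponential type and polynomial growth on `ℝ` is bounded in the upper half-plane
by a polynomial times `e^{(a+ε) Im z}`. -/
lemma norm_le_of_expType_of_polyGrowth {a : ℝ} (ha : 0 ≤ a) {f : ℂ → ℂ} (hf : f ∈ ExpType a)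
    (hg : PolyGrowth (restrictReal f)) {ε : ℝ} (hε : 0 < ε) :
    ∃ C : ℝ, ∃ M : ℕ, 0 ≤ C ∧ ∀ z : ℂ, 0 ≤ z.im →
      ‖f z‖ ≤ C * ‖z + Complex.I‖ ^ M * Real.exp ((a + ε) * z.im) := by
  obtain ⟨C, M, hC0, hC⟩ := hg
  obtain ⟨hd, hexp⟩ := hf
  have hden : ∀ w : ℂ, 0 ≤ w.re → 1 ≤ ‖w + 1‖ := fun w hw => by
    have h1 := Complex.abs_re_le_norm (w + 1)
    have h2 : (w + 1).re = w.re + 1 := by simp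
    rw [h2, abs_of_nonneg (by linarith)] at h1
    linarith
  -- With `z = iw` the upper half-plane becomes `Re w > 0`. The denominator bounds `F` on the
  -- imaginary axis and the exponential bounds it on the positive real axis; the growth order is `1
  -- < 2`, as Phragmén–Lindelöf requires.
  let F : ℂ → ℂ := fun w => f (Complex.I * w) / (w + 1) ^ M * Complex.exp (-((a + ε : ℝ) * w))
  have hFn : ∀ w : ℂ, ‖F w‖ = ‖f (Complex.I * w)‖ / ‖w + 1‖ ^ M * Real.exp (-((a + ε) * w.re)) := by
    intro w
    simp only [F]
    rw [norm_mul, norm_div, norm_pow, Complex.norm_exp]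
    simp
  have hdF : DiffContOnCl ℂ F {z | 0 < z.re} := by
    refine DifferentiableOn.diffContOnCl ?_
    rw [Complex.closure_setOfPred_lt_re]
    intro w hw
    have hw' : (w + 1) ^ M ≠ 0 := by
      refine pow_ne_zero _ fun h => ?_
      have := hden w hw
      rw [h, norm_zero] at this
      linarith
    refine DifferentiableAt.differentiableWithinAt ?_
    refine DifferentiableAt.mul (DifferentiableAt.div ?_ (by fun_prop) hw') (by fun_prop)
    exact (hd _).comp w (by fun_prop)
  have hbound : ∀ w : ℂ, 0 ≤ w.re → ‖F w‖ ≤ C * 2 ^ M := by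
    intro w hw
    refine PhragmenLindelof.right_half_plane_of_bounded_on_real hdF ?_ ?_ ?_ hw
    · obtain ⟨D, hD0, hD⟩ := hexp 1 one_pos
      refine ⟨1, by norm_num, a + 1, ?_⟩
      refine Asymptotics.IsBigO.of_bound D ?_
      rw [eventually_inf_principal]
      refine Eventually.of_forall fun z hz => ?_
      have hz' : 0 < z.re := hz
      rw [hFn, Real.norm_of_nonneg (Real.exp_pos _).le, Real.rpow_one]
      have h1 : Real.exp (-((a + ε) * z.re)) ≤ 1 := by
        rw [Real.exp_le_one_iff]
        have : 0 ≤ (a + ε) * z.re := by positivity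
        linarith
      have h2 : ‖f (Complex.I * z)‖ / ‖z + 1‖ ^ M ≤ ‖f (Complex.I * z)‖ :=
        div_le_self (norm_nonneg _) (one_le_pow₀ (hden z hz'.le))
      have h3 := hD (Complex.I * z)
      rw [norm_mul, Complex.norm_I, one_mul] at h3
      calc _ ≤ ‖f (Complex.I * z)‖ * 1 := by gcongr
        _ ≤ _ := by rw [mul_one]; exact h3
    · obtain ⟨D, hD0, hD⟩ := hexp ε hε
      refine ⟨D, ?_⟩
      rw [eventually_map]
      filter_upwards [eventually_ge_atTop (0:ℝ)] with x hx
      rw [hFn]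
      have h2 : ‖f (Complex.I * x)‖ / ‖(x:ℂ) + 1‖ ^ M ≤ ‖f (Complex.I * x)‖ :=
        div_le_self (norm_nonneg _) (one_le_pow₀ (hden x (by simpa using hx)))
      have h3 := hD (Complex.I * x)
      rw [norm_mul, Complex.norm_I, one_mul, Complex.norm_real, Real.norm_of_nonneg hx] at h3
      calc _ ≤ D * Real.exp ((a + ε) * x) * Real.exp (-((a + ε) * (x:ℂ).re)) := by
            gcongr; exact h2.trans h3
        _ = D := by
            rw [Complex.ofReal_re, mul_assoc, ← Real.exp_add, add_neg_cancel, Real.exp_zero, mul_one]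
    · intro x
      rw [hFn]
      have e1 : Complex.I * (x * Complex.I) = ((-x : ℝ) : ℂ) := by
        rw [mul_left_comm, Complex.I_mul_I]; push_cast; ring
      have e2 : ((x:ℂ) * Complex.I).re = 0 := by simp
      rw [e1, e2, mul_zero, neg_zero, Real.exp_zero, mul_one]
      have h1 := hC (-x)
      rw [abs_neg] at h1
      have h2 : 1 + |x| ≤ 2 * ‖(x:ℂ) * Complex.I + 1‖ := by
        have h3 := Complex.abs_re_le_norm ((x:ℂ) * Complex.I + 1)
        have h4 := Complex.abs_im_le_norm ((x:ℂ) * Complex.I + 1)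
        simp at h3 h4
        linarith
      have hpos : 0 < ‖(x:ℂ) * Complex.I + 1‖ := by
        have := abs_nonneg x
        linarith
      rw [div_le_iff₀ (by positivity)]
      calc _ ≤ C * (1 + |x|) ^ M := h1
        _ ≤ C * (2 * ‖(x:ℂ) * Complex.I + 1‖) ^ M := by gcongr
        _ = _ := by rw [mul_pow]; ring
  refine ⟨C * 2 ^ M, M, by positivity, fun z hz => ?_⟩
  have h := hbound (-Complex.I * z) (by simpa using hz)
  rw [hFn] at h
  have e1 : Complex.I * (-Complex.I * z) = z := by
    rw [← mul_assoc, mul_neg, Complex.I_mul_I, neg_neg, one_mul]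
  have e2 : (-Complex.I * z).re = z.im := by simp
  have e3 : ‖-Complex.I * z + 1‖ = ‖z + Complex.I‖ := by
    have : -Complex.I * z + 1 = -Complex.I * (z + Complex.I) := by
      rw [mul_add, neg_mul Complex.I Complex.I, Complex.I_mul_I]; ring
    rw [this, norm_mul, norm_neg, Complex.norm_I, one_mul]
  rw [e1, e2, e3] at h
  have hpos : 0 < ‖z + Complex.I‖ := by
    have h4 := Complex.abs_im_le_norm (z + Complex.I)
    have : (z + Complex.I).im = z.im + 1 := by simp
    rw [this, abs_of_nonneg (by linarith)] at h4
    linarith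
  rw [Real.exp_neg, ← div_eq_mul_inv, div_div, div_le_iff₀ (by positivity)] at h
  rw [mul_assoc]
  exact h

/-- Contour shift: an entire function with decay in the upper half-plane has integral zero. -/
lemma integral_eq_zero_of_decay {H : ℂ → ℂ} (hd : Differentiable ℂ H) {C δ : ℝ} (hC : 0 ≤ C)
    (hδ : 0 < δ)
    (hH : ∀ z : ℂ, 0 ≤ z.im → ‖H z‖ * ‖z + Complex.I‖ ^ 2 ≤ C * Real.exp (-(δ * z.im))) :
    ∫ x : ℝ, H x = 0 := by
  have hsq : ∀ z : ℂ, 0 ≤ z.im → 1 + z.re ^ 2 ≤ ‖z + Complex.I‖ ^ 2 := fun z hz => by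
    rw [Complex.sq_norm, Complex.normSq_apply]
    simp only [Complex.add_re, Complex.I_re, Complex.add_im, Complex.I_im]
    nlinarith
  have hint : Integrable (fun x : ℝ => H x) := by
    refine (integrable_inv_one_add_sq.const_mul C).mono' ?_ (ae_of_all _ fun x => ?_)
    · exact (hd.continuous.comp Complex.continuous_ofReal).aestronglyMeasurable
    · have h1 := hH x (by simp)
      have h2 := hsq x (by simp)
      simp only [Complex.ofReal_im, mul_zero, neg_zero, Real.exp_zero, mul_one,
        Complex.ofReal_re] at h1 h2
      rw [← div_eq_mul_inv, le_div_iff₀ (by positivity)]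
      exact (mul_le_mul_of_nonneg_left h2 (norm_nonneg _)).trans h1
  have hlim := intervalIntegral_tendsto_integral hint tendsto_neg_atTop_atBot tendsto_id
  refine tendsto_nhds_unique hlim ?_
  -- Cauchy's theorem on `[-R, R] × [0, R]`: the first term bounds the top edge, and each vertical
  -- side has length `R` and integrand at most `C/R²`.
  have hb : ∀ R : ℝ, 0 < R → ‖∫ x : ℝ in (-R)..R, H x‖ ≤
      C * (2 * R * Real.exp (-(δ * R))) + 2 * (C * R⁻¹) := by
    intro R hR
    have hrect := Complex.integral_boundary_rect_eq_zero_of_differentiableOn H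
      ((-R : ℝ) : ℂ) (R + R * Complex.I) hd.differentiableOn
    simp only [Complex.ofReal_re, Complex.ofReal_im, Complex.add_re, Complex.mul_re, Complex.I_re,
      mul_zero, Complex.I_im, mul_one, sub_self, add_zero, Complex.add_im, Complex.mul_im,
      zero_add, Complex.ofReal_zero, zero_mul, smul_eq_mul] at hrect
    have htop : ‖∫ x : ℝ in (-R)..R, H (x + R * Complex.I)‖ ≤
        C * Real.exp (-(δ * R)) * |R - -R| := by
      refine intervalIntegral.norm_integral_le_of_norm_le_const fun x _ => ?_
      have him : ((x:ℂ) + R * Complex.I).im = R := by simp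
      have h1 := hH (x + R * Complex.I) (by rw [him]; exact hR.le)
      have h2 := hsq (x + R * Complex.I) (by rw [him]; exact hR.le)
      rw [him] at h1
      have h3 : 1 ≤ ‖(x:ℂ) + R * Complex.I + Complex.I‖ ^ 2 := by
        have := sq_nonneg ((x : ℂ) + R * Complex.I).re
        linarith
      exact (le_mul_of_one_le_right (norm_nonneg _) h3).trans h1
    have hside : ∀ r : ℝ, |r| = R → ‖∫ y : ℝ in (0:ℝ)..R, H (r + y * Complex.I)‖ ≤
        C * (R ^ 2)⁻¹ * |R - 0| := by
      intro r hr
      refine intervalIntegral.norm_integral_le_of_norm_le_const fun y hy => ?_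
      rw [Set.uIoc_of_le hR.le] at hy
      have him : ((r:ℂ) + y * Complex.I).im = y := by simp
      have hre : ((r:ℂ) + y * Complex.I).re = r := by simp
      have h1 := hH (r + y * Complex.I) (by rw [him]; exact hy.1.le)
      have h2 := hsq (r + y * Complex.I) (by rw [him]; exact hy.1.le)
      rw [him] at h1
      rw [hre, ← sq_abs, hr] at h2
      rw [← div_eq_mul_inv, le_div_iff₀ (by positivity)]
      have h3 : Real.exp (-(δ * y)) ≤ 1 := by
        rw [Real.exp_le_one_iff]
        have : 0 ≤ δ * y := mul_nonneg hδ.le hy.1.le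
        linarith
      calc _ ≤ ‖H (r + y * Complex.I)‖ * ‖(r:ℂ) + y * Complex.I + Complex.I‖ ^ 2 :=
            mul_le_mul_of_nonneg_left (by linarith) (norm_nonneg _)
        _ ≤ C * Real.exp (-(δ * y)) := h1
        _ ≤ C := mul_le_of_le_one_right hC h3
    have h1 := hside R (abs_of_pos hR)
    have h2 := hside (-R) (by rw [abs_neg, abs_of_pos hR])
    rw [sub_zero, abs_of_pos hR] at h1 h2
    rw [sub_neg_eq_add, abs_of_pos (by linarith)] at htop
    have e : ∫ x : ℝ in (-R)..R, H x = (∫ x : ℝ in (-R)..R, H (x + R * Complex.I)) -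
        Complex.I * (∫ y : ℝ in (0:ℝ)..R, H (R + y * Complex.I)) +
        Complex.I * (∫ y : ℝ in (0:ℝ)..R, H (((-R : ℝ) : ℂ) + y * Complex.I)) := by
      linear_combination hrect
    rw [e]
    have e2 : C * (R ^ 2)⁻¹ * R = C * R⁻¹ := by field_simp
    rw [e2] at h1 h2
    refine (norm_add_le _ _).trans ?_
    have h3 := norm_sub_le (∫ x : ℝ in (-R)..R, H (x + R * Complex.I))
      (Complex.I * (∫ y : ℝ in (0:ℝ)..R, H (R + y * Complex.I)))
    rw [norm_mul, Complex.norm_I, one_mul] at h3 ⊢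
    nlinarith
  have hz : Tendsto (fun R : ℝ => C * (2 * R * Real.exp (-(δ * R))) + 2 * (C * R⁻¹)) atTop (𝓝 0) := by
    have h1 : Tendsto (fun R : ℝ => R * Real.exp (-(δ * R))) atTop (𝓝 0) := by
      have := tendsto_rpow_mul_exp_neg_mul_atTop_nhds_zero 1 δ hδ
      simpa using this
    have h2 := (h1.const_mul (C * 2)).add ((tendsto_inv_atTop_zero (𝕜 := ℝ)).const_mul (2 * C))
    simp only [mul_zero, add_zero] at h2
    refine h2.congr fun R => ?_
    ring
  refine squeeze_zero_norm' ?_ hz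
  filter_upwards [eventually_gt_atTop (0:ℝ)] with R hR
  exact hb R hR

/-- Smooth densities with compact support in an interval. -/
structure SmoothDensity (b : ℝ) (v : ℝ → ℂ) : Prop where
  smooth : ContDiff ℝ ∞ v
  compact : HasCompactSupport v
  supp : tsupport v ⊆ Set.Ici b

namespace SmoothDensity

variable {b : ℝ} {v : ℝ → ℂ}

lemma exists_bandDensity (h : SmoothDensity b v) : ∃ B, BandDensity B 0 v := by
  obtain ⟨B, hB⟩ := h.compact.isCompact.isBounded.exists_norm_le
  refine ⟨B, h.smooth.continuous.aestronglyMeasurable, fun ξ hξ => ?_, ?_⟩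
  · refine image_eq_zero_of_notMem_tsupport fun h' => hξ ?_
    exact abs_le.1 (hB ξ h')
  · simpa using (h.smooth.continuous.integrable_of_hasCompactSupport h.compact).norm

lemma differentiable (h : SmoothDensity b v) : Differentiable ℂ (bandInt 0 v) := by
  obtain ⟨B, hB⟩ := h.exists_bandDensity
  exact hB.differentiable_bandInt

lemma step (h : SmoothDensity b v) :
    SmoothDensity b (fun ξ => Complex.I * (deriv v ξ + v ξ)) where
  smooth := contDiff_const.mul ((h.smooth.deriv' ).add h.smooth)
  compact := (h.compact.deriv.add h.compact).mul_left
  supp := by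
    refine (tsupport_mul_subset_right (f := fun _ => Complex.I)).trans ?_
    refine (tsupport_add (deriv v) v).trans (Set.union_subset ?_ h.supp)
    exact fun ξ hξ => h.supp (tsupport_deriv_subset hξ)

/-- Integration by parts replaces `v'` by `-iz v`, and `i(-iz + 1) = z + i`. Multiplication by `z +
i`, which has no zero in the closed upper half-plane, thus stays within smooth densities. -/
lemma bandInt_step (h : SmoothDensity b v) (z : ℂ) :
    bandInt 0 (fun ξ => Complex.I * (deriv v ξ + v ξ)) z = (z + Complex.I) * bandInt 0 v z := by
  have hcont : Continuous fun ξ : ℝ => Complex.exp (Complex.I * z * ξ) := by fun_prop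
  have hdv : Continuous (deriv v) := h.smooth.continuous_deriv (by simp)
  have i1 : Integrable (fun ξ : ℝ => deriv v ξ * Complex.exp (Complex.I * z * ξ)) :=
    (hdv.mul hcont).integrable_of_hasCompactSupport h.compact.deriv.mul_right
  have i2 : Integrable (fun ξ : ℝ => v ξ * Complex.exp (Complex.I * z * ξ)) :=
    (h.smooth.continuous.mul hcont).integrable_of_hasCompactSupport h.compact.mul_right
  have hd : ∀ ξ : ℝ, HasDerivAt (fun ξ : ℝ => v ξ * Complex.exp (Complex.I * z * ξ))
      (deriv v ξ * Complex.exp (Complex.I * z * ξ) +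
        Complex.I * z * (v ξ * Complex.exp (Complex.I * z * ξ))) ξ := by
    intro ξ
    have h1 : HasDerivAt v (deriv v ξ) ξ := (h.smooth.differentiable (by simp) ξ).hasDerivAt
    have h2 : HasDerivAt (fun ξ : ℝ => Complex.I * z * (ξ : ℂ)) (Complex.I * z) ξ := by
      simpa using (Complex.ofRealCLM.hasDerivAt (x := ξ)).const_mul (Complex.I * z)
    refine (h1.mul h2.cexp).congr_deriv ?_
    ring
  have hz := integral_eq_zero_of_hasDerivAt_of_integrable hd (i1.add (i2.const_mul _)) i2
  rw [integral_add i1 (i2.const_mul _), integral_const_mul] at hz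
  unfold bandInt
  simp only [expRem_zero]
  have e : ∀ ξ : ℝ, Complex.I * (deriv v ξ + v ξ) * Complex.exp (Complex.I * z * ξ) =
      Complex.I * (deriv v ξ * Complex.exp (Complex.I * z * ξ)) +
      Complex.I * (v ξ * Complex.exp (Complex.I * z * ξ)) := fun ξ => by ring
  rw [integral_congr_ae (ae_of_all _ e), integral_add (i1.const_mul _) (i2.const_mul _),
    integral_const_mul, integral_const_mul]
  linear_combination Complex.I * hz - z * (∫ ξ : ℝ, v ξ * Complex.exp (Complex.I * z * ξ)) *
    Complex.I_mul_I

lemma norm_bandInt_le (h : SmoothDensity b v) {z : ℂ} (hz : 0 ≤ z.im) :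
    ‖bandInt 0 v z‖ ≤ (∫ ξ, ‖v ξ‖) * Real.exp (-(b * z.im)) := by
  rw [← integral_mul_const]
  refine norm_integral_le_of_norm_le
    ((h.smooth.continuous.integrable_of_hasCompactSupport h.compact).norm.mul_const _)
    (ae_of_all _ fun ξ => ?_)
  rw [norm_mul, expRem_zero, Complex.norm_exp]
  by_cases hξ : ξ ∈ tsupport v
  · have hb : b ≤ ξ := h.supp hξ
    refine mul_le_mul_of_nonneg_left ?_ (norm_nonneg _)
    rw [Real.exp_le_exp]
    simp
    nlinarith
  · rw [image_eq_zero_of_notMem_tsupport hξ]; simp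

lemma exists_decay (h : SmoothDensity b v) (K : ℕ) :
    ∃ C : ℝ, 0 ≤ C ∧ ∀ z : ℂ, 0 ≤ z.im →
      ‖z + Complex.I‖ ^ K * ‖bandInt 0 v z‖ ≤ C * Real.exp (-(b * z.im)) := by
  induction K generalizing v with
  | zero =>
    exact ⟨∫ ξ, ‖v ξ‖, integral_nonneg fun ξ => norm_nonneg _, fun z hz => by
      simpa using h.norm_bandInt_le hz⟩
  | succ K ih =>
    obtain ⟨C, hC0, hC⟩ := ih h.step
    refine ⟨C, hC0, fun z hz => ?_⟩
    have := hC z hz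
    rw [h.bandInt_step, norm_mul] at this
    rw [pow_succ, mul_assoc]
    exact this

end SmoothDensity

lemma fourierInvT_eq_bandInt (v : ℝ → ℂ) (x : ℝ) : fourierInvT v x = fc * bandInt 0 v x := by
  simp only [bandInt, expRem_zero]; rfl

/-- A function of exponential type `a` with polynomial growth on `ℝ` has no frequencies
above `a`. -/
lemma integral_mul_fourierInvT_eq_zero {a b : ℝ} (ha : 0 ≤ a) (hab : a < b) {f : ℂ → ℂ}
    (hf : f ∈ ExpType a) (hg : PolyGrowth (restrictReal f)) {v : ℝ → ℂ}
    (hv : SmoothDensity b v) : ∫ x, restrictReal f x * fourierInvT v x = 0 := by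
  -- Half of the gap `b - a` is spent on `ε`, the other half remains as decay in `Im z`. The two
  -- extra powers in `M + 2` below give integrability on horizontal lines.
  obtain ⟨C, M, hC0, hC⟩ := norm_le_of_expType_of_polyGrowth ha hf hg
    (ε := (b - a) / 2) (by linarith)
  obtain ⟨D, hD0, hD⟩ := hv.exists_decay (M + 2)
  have h0 : ∫ x : ℝ, (fun z : ℂ => f z * bandInt 0 v z) x = 0 := by
    refine integral_eq_zero_of_decay (hf.1.mul hv.differentiable) (C := C * D)
      (δ := (b - a) / 2) (by positivity) (by linarith) fun z hz => ?_
    have h1 := hC z hz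
    have h2 := hD z hz
    calc ‖f z * bandInt 0 v z‖ * ‖z + Complex.I‖ ^ 2
        = ‖f z‖ * ‖bandInt 0 v z‖ * ‖z + Complex.I‖ ^ 2 := by rw [norm_mul]
      _ ≤ (C * ‖z + Complex.I‖ ^ M * Real.exp ((a + (b - a) / 2) * z.im)) *
          ‖bandInt 0 v z‖ * ‖z + Complex.I‖ ^ 2 := by gcongr
      _ = C * Real.exp ((a + (b - a) / 2) * z.im) *
          (‖z + Complex.I‖ ^ (M + 2) * ‖bandInt 0 v z‖) := by rw [pow_add]; ring
      _ ≤ C * Real.exp ((a + (b - a) / 2) * z.im) * (D * Real.exp (-(b * z.im))) := by gcongr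
      _ = C * D * Real.exp (-((b - a) / 2 * z.im)) := by
        rw [show -((b - a) / 2 * z.im) = (a + (b - a) / 2) * z.im + -(b * z.im) by ring,
          Real.exp_add]
        ring
  have e : ∀ x : ℝ, restrictReal f x * fourierInvT v x =
      fc * (fun z : ℂ => f z * bandInt 0 v z) x := fun x => by
    rw [fourierInvT_eq_bandInt]; simp only [restrictReal]; ring
  rw [integral_congr_ae (ae_of_all _ e), integral_const_mul, h0, mul_zero]

/-! ### Growth on the real line -/

lemma PolyGrowth.of_deriv {f : ℝ → ℂ} (hf : Differentiable ℝ f) (h : PolyGrowth (deriv f)) :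
    PolyGrowth f := by
  obtain ⟨C, M, hC0, hC⟩ := h
  refine ⟨‖f 0‖ + C, M + 1, by positivity, fun x => ?_⟩
  have key := (convex_uIcc (0:ℝ) x).norm_image_sub_le_of_norm_deriv_le (f := f)
    (C := C * (1 + |x|) ^ M) (fun t _ => hf t)
    (fun t ht => by
      refine (hC t).trans ?_
      have : |t| ≤ |x| := by
        rcases le_total 0 x with h | h
        · rw [Set.uIcc_of_le h] at ht
          rw [abs_of_nonneg h, abs_of_nonneg ht.1]; exact ht.2
        · rw [Set.uIcc_of_ge h] at ht
          rw [abs_of_nonpos h, abs_of_nonpos ht.2]; linarith [ht.1]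
      gcongr)
    Set.left_mem_uIcc Set.right_mem_uIcc
  rw [sub_zero, Real.norm_eq_abs] at key
  have h1 : ‖f x‖ ≤ ‖f 0‖ + ‖f x - f 0‖ := by
    calc ‖f x‖ = ‖f 0 + (f x - f 0)‖ := by ring_nf
      _ ≤ _ := norm_add_le _ _
  have h2 : (1:ℝ) ≤ (1 + |x|) ^ (M + 1) := one_le_pow₀ (by linarith [abs_nonneg x])
  have h3 : C * (1 + |x|) ^ M * |x| ≤ C * (1 + |x|) ^ (M + 1) := by
    rw [pow_succ, mul_assoc]
    gcongr
    linarith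
  have h4 : ‖f 0‖ ≤ ‖f 0‖ * (1 + |x|) ^ (M + 1) := le_mul_of_one_le_right (norm_nonneg _) h2
  rw [add_mul]
  linarith

lemma PolyGrowth.of_iteratedDeriv {f : ℝ → ℂ} (hf : ContDiff ℝ ∞ f) (n : ℕ)
    (h : PolyGrowth (iteratedDeriv n f)) : PolyGrowth f := by
  induction n generalizing f with
  | zero => simpa using h
  | succ n ih =>
    rw [iteratedDeriv_succ'] at h
    exact (ih hf.deriv' h).of_deriv (hf.differentiable (by simp))

/-- A Hölder function of order at most one grows at most linearly; integrating `⌊γ⌋₊` times adds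
finitely many powers. -/
lemma polyGrowth_of_homLipschitz {γ : ℝ} (hγ : 0 ≤ γ) {f : ℝ → ℂ} (hf : ContDiff ℝ ∞ f)
    (h : HomLipschitz γ f) : PolyGrowth f := by
  obtain ⟨-, C, hC⟩ := h
  refine PolyGrowth.of_iteratedDeriv hf ⌊γ⌋₊ ?_
  set φ := iteratedDeriv ⌊γ⌋₊ f
  have h0 : 0 ≤ γ - ⌊γ⌋₊ := by linarith [Nat.floor_le hγ]
  have h1 : γ - ⌊γ⌋₊ ≤ 1 := by linarith [Nat.lt_floor_add_one γ]
  refine ⟨‖φ 0‖ + |C|, 1, by positivity, fun x => ?_⟩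
  have hx := hC x 0
  rw [sub_zero] at hx
  have h2 : |x| ^ (γ - ⌊γ⌋₊) ≤ 1 + |x| := by
    rcases le_total |x| 1 with h | h
    · have := Real.rpow_le_one (abs_nonneg x) h h0
      linarith [abs_nonneg x]
    · have := Real.rpow_le_rpow_of_exponent_le h h1
      rw [Real.rpow_one] at this; linarith
  have h3 : C * |x| ^ (γ - ⌊γ⌋₊) ≤ |C| * (1 + |x|) :=
    (mul_le_mul_of_nonneg_right (le_abs_self C) (by positivity)).trans
      (mul_le_mul_of_nonneg_left h2 (abs_nonneg _))
  have h4 : ‖φ x‖ ≤ ‖φ 0‖ + ‖φ x - φ 0‖ := by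
    calc ‖φ x‖ = ‖φ 0 + (φ x - φ 0)‖ := by ring_nf
      _ ≤ _ := norm_add_le _ _
  have h5 : ‖φ 0‖ ≤ ‖φ 0‖ * (1 + |x|) :=
    le_mul_of_one_le_right (norm_nonneg _) (by linarith [abs_nonneg x])
  rw [pow_one, add_mul]
  linarith

lemma PolyGrowth.integrable_mul {f : ℝ → ℂ} (hf : Continuous f) (h : PolyGrowth f)
    (ψ : 𝓢(ℝ, ℂ)) : Integrable (fun x => f x * ψ x) := by
  obtain ⟨C, M, hC0, hC⟩ := h
  have hi := ((ψ.integrable.norm).add (ψ.integrable_pow_mul volume M)).const_mul (C * 2 ^ M)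
  refine hi.mono' (hf.mul ψ.continuous).aestronglyMeasurable (ae_of_all _ fun x => ?_)
  rw [norm_mul, Pi.add_apply, ← one_add_mul, ← mul_assoc]
  refine mul_le_mul_of_nonneg_right ((hC x).trans ?_) (norm_nonneg _)
  rw [mul_assoc]
  refine mul_le_mul_of_nonneg_left ?_ hC0
  rw [Real.norm_eq_abs]
  rcases le_total |x| 1 with h | h
  · calc (1 + |x|) ^ M ≤ 2 ^ M := by gcongr; linarith
      _ ≤ 2 ^ M * (1 + |x| ^ M) := le_mul_of_one_le_right (by positivity)
        (by linarith [pow_nonneg (abs_nonneg x) M])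
  · calc (1 + |x|) ^ M ≤ (2 * |x|) ^ M := by gcongr; linarith
      _ = 2 ^ M * |x| ^ M := mul_pow _ _ _
      _ ≤ _ := by gcongr; linarith

lemma norm_le_one_add_rpow {p : ℝ} (hp : 1 ≤ p) {t : ℝ} (ht : 0 ≤ t) : t ≤ 1 + t ^ p := by
  rcases le_total t 1 with h | h
  · linarith [Real.rpow_nonneg ht p]
  · have := Real.rpow_le_rpow_of_exponent_le h hp
    rw [Real.rpow_one] at this; linarith

/-- An entire function of exponential type in `L^p(ℝ)` has a primitive of the same type which
grows at most polynomially on `ℝ`. -/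
lemma exists_primitive_polyGrowth {a : ℝ} (ha : 0 ≤ a) {f : ℂ → ℂ} (hf : f ∈ ExpType a)
    {p : ℝ} (hp : 1 ≤ p) (hfp : Integrable (fun x => ‖restrictReal f x‖ ^ p)) :
    ∃ P : ℂ → ℂ, P ∈ ExpType a ∧ (∀ z, HasDerivAt P (f z) z) ∧ PolyGrowth (restrictReal P) := by
  obtain ⟨P, hP0, hP⟩ := hf.1.isExactOn_univ.with_val_at 0 0
  have hP' : ∀ z, HasDerivAt P (f z) z := fun z => hP z (Set.mem_univ z)
  refine ⟨P, ⟨fun z => (hP' z).differentiableAt, fun ε hε => ?_⟩, hP', ?_⟩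
  · obtain ⟨C, hC0, hC⟩ := hf.2 (ε / 2) (by positivity)
    refine ⟨C * (2 / ε), by positivity, fun z => ?_⟩
    have key := (convex_closedBall (0:ℂ) ‖z‖).norm_image_sub_le_of_norm_hasDerivWithin_le
      (f := P) (C := C * Real.exp ((a + ε / 2) * ‖z‖)) (x := 0) (y := z)
      (fun w _ => (hP' w).hasDerivWithinAt)
      (fun w hw => by
        refine (hC w).trans ?_
        have : ‖w‖ ≤ ‖z‖ := by simpa using hw
        gcongr)
      (by simp) (by simp)
    rw [hP0, sub_zero, sub_zero] at key
    refine key.trans ?_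
    have h1 : ‖z‖ ≤ 2 / ε * Real.exp (ε / 2 * ‖z‖) := by
      have := Real.add_one_le_exp (ε / 2 * ‖z‖)
      rw [div_mul_eq_mul_div, le_div_iff₀ hε]
      linarith
    calc C * Real.exp ((a + ε / 2) * ‖z‖) * ‖z‖
        ≤ C * Real.exp ((a + ε / 2) * ‖z‖) * (2 / ε * Real.exp (ε / 2 * ‖z‖)) := by gcongr
      _ = C * (2 / ε) * Real.exp ((a + ε) * ‖z‖) := by
        rw [show (a + ε) * ‖z‖ = (a + ε / 2) * ‖z‖ + ε / 2 * ‖z‖ by ring, Real.exp_add]; ring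
  · have hcont : Continuous (restrictReal f) := hf.1.continuous.comp Complex.continuous_ofReal
    set J := ∫ x, ‖restrictReal f x‖ ^ p with hJ
    have hJ0 : 0 ≤ J := integral_nonneg fun x => by positivity
    refine ⟨1 + J, 1, by positivity, fun x => ?_⟩
    have hFTC : ∫ t in (0:ℝ)..x, restrictReal f t = restrictReal P x := by
      have hd : ∀ t ∈ Set.uIcc 0 x, HasDerivAt (restrictReal P) (restrictReal f t) t :=
        fun t _ => (hP' (t:ℂ)).comp_ofReal
      rw [intervalIntegral.integral_eq_sub_of_hasDerivAt hd (hcont.intervalIntegrable _ _)]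
      simp [restrictReal, hP0]
    rw [← hFTC, pow_one]
    have h1 : ‖∫ t in (0:ℝ)..x, restrictReal f t‖ ≤
        ∫ t in Set.uIoc 0 x, (1 + ‖restrictReal f t‖ ^ p) := by
      refine (intervalIntegral.norm_integral_le_integral_norm_uIoc).trans ?_
      refine setIntegral_mono ?_ ?_ fun t => norm_le_one_add_rpow hp (norm_nonneg _)
      · exact (intervalIntegrable_iff.1 (hcont.intervalIntegrable 0 x)).norm
      · exact (integrableOn_const (by simp [Set.uIoc]) (by simp)).add hfp.integrableOn
    have h2 : ∫ t in Set.uIoc 0 x, (1 + ‖restrictReal f t‖ ^ p) ≤ |x| + J := by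
      have hc : Integrable (fun _ : ℝ => (1:ℝ)) (volume.restrict (Set.uIoc 0 x)) :=
        integrableOn_const (by simp [Set.uIoc]) (by simp)
      rw [integral_add hc hfp.integrableOn]
      refine add_le_add (le_of_eq ?_) (setIntegral_le_integral hfp
        (ae_of_all _ fun t => by positivity))
      rw [setIntegral_const, smul_eq_mul, mul_one, Set.uIoc, Real.volume_real_Ioc]
      rw [max_eq_left (by simp), max_sub_min_eq_abs]; simp
    nlinarith [abs_nonneg x]

/-- The growth conditions on the real line that occur for fractional Paley--Wiener functions. -/
def Tame (f : ℝ → ℂ) : Prop :=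
  PolyGrowth f ∨ ∃ p : ℝ, 1 ≤ p ∧ Integrable (fun x => ‖f x‖ ^ p)

lemma Tame.comp_neg {f : ℝ → ℂ} (h : Tame f) : Tame (fun x => f (-x)) := by
  rcases h with ⟨C, M, hC0, hC⟩ | ⟨p, hp, hi⟩
  · exact Or.inl ⟨C, M, hC0, fun x => by simpa using hC (-x)⟩
  · exact Or.inr ⟨p, hp, hi.comp_neg⟩

namespace SmoothDensity

variable {b : ℝ} {v : ℝ → ℂ}

/-- A smooth density as a Schwartz function. -/
noncomputable def toSchwartz (h : SmoothDensity b v) : 𝓢(ℝ, ℂ) := h.compact.toSchwartzMap h.smooth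

lemma coe_iftS_toSchwartz (h : SmoothDensity b v) :
    (iftS h.toSchwartz : ℝ → ℂ) = fourierInvT v := by rw [coe_iftS]; rfl

lemma I_mul (h : SmoothDensity b v) : SmoothDensity b (fun ξ => Complex.I * ξ * v ξ) where
  smooth := (contDiff_const.mul Complex.ofRealCLM.contDiff).mul h.smooth
  compact := h.compact.mul_left
  supp := tsupport_mul_subset_right.trans h.supp

lemma hasDerivAt_fourierInvT (h : SmoothDensity b v) (x : ℝ) :
    HasDerivAt (fourierInvT v) (fourierInvT (fun ξ => Complex.I * ξ * v ξ) x) x := by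
  obtain ⟨B, hB⟩ := h.exists_bandDensity
  have e : fourierInvT v = fun x : ℝ => fc * bandInt 0 v x := funext (fourierInvT_eq_bandInt v)
  rw [e, fourierInvT_eq_bandInt]
  exact (hB.hasDerivAt_bandInt (x:ℂ)).comp_ofReal.const_mul fc

end SmoothDensity

/-- In the `L^p` case, integration by parts moves the derivative from the primitive `P` onto
`fourierInvT v`. This multiplies the density by `iξ`, leaving its support in `[b, ∞)`, so the
polynomial-growth case applies to `P`. -/
lemma integral_mul_fourierInvT_eq_zero_of_tame {a b : ℝ} (ha : 0 ≤ a) (hab : a < b) {f : ℂ → ℂ}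
    (hf : f ∈ ExpType a) (hg : Tame (restrictReal f)) {v : ℝ → ℂ}
    (hv : SmoothDensity b v) : ∫ x, restrictReal f x * fourierInvT v x = 0 := by
  rcases hg with hg | ⟨p, hp, hi⟩
  · exact integral_mul_fourierInvT_eq_zero ha hab hf hg hv
  · obtain ⟨P, hPE, hP', hPg⟩ := exists_primitive_polyGrowth ha hf hp hi
    have hcf : Continuous (restrictReal f) := hf.1.continuous.comp Complex.continuous_ofReal
    have hcP : Continuous (restrictReal P) := hPE.1.continuous.comp Complex.continuous_ofReal
    have i1 : Integrable (fun x => restrictReal P x * fourierInvT (fun ξ => Complex.I * ξ * v ξ) x) := by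
      rw [← hv.I_mul.coe_iftS_toSchwartz]
      exact hPg.integrable_mul hcP _
    have i3 : Integrable (fun x => restrictReal P x * fourierInvT v x) := by
      rw [← hv.coe_iftS_toSchwartz]
      exact hPg.integrable_mul hcP _
    have i2 : Integrable (fun x => restrictReal f x * fourierInvT v x) := by
      rw [← hv.coe_iftS_toSchwartz]
      set χ := iftS hv.toSchwartz
      obtain ⟨C, hC⟩ := χ.decay 0 0
      have hb : ∀ ξ, ‖χ ξ‖ ≤ C := fun ξ => by simpa using hC.2 ξ
      refine (χ.integrable.norm.add (hi.const_mul C)).mono'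
        (hcf.mul χ.continuous).aestronglyMeasurable (ae_of_all _ fun x => ?_)
      rw [norm_mul, Pi.add_apply]
      calc ‖restrictReal f x‖ * ‖χ x‖ ≤ (1 + ‖restrictReal f x‖ ^ p) * ‖χ x‖ := by
            gcongr; exact norm_le_one_add_rpow hp (norm_nonneg _)
        _ = ‖χ x‖ + ‖restrictReal f x‖ ^ p * ‖χ x‖ := by ring
        _ ≤ ‖χ x‖ + ‖restrictReal f x‖ ^ p * C := by gcongr; exact hb x
        _ = _ := by ring
    have hz := integral_eq_zero_of_hasDerivAt_of_integrable
      (f := fun x => restrictReal P x * fourierInvT v x)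
      (fun x => ((hP' (x:ℂ)).comp_ofReal).mul (hv.hasDerivAt_fourierInvT x)) (i2.add i1) i3
    have hz' : ∫ x, (restrictReal f x * fourierInvT v x +
        restrictReal P x * fourierInvT (fun ξ => Complex.I * ξ * v ξ) x) = 0 := hz
    rw [integral_add i2 i1, integral_mul_fourierInvT_eq_zero ha hab hPE hPg hv.I_mul,
      add_zero] at hz'
    exact hz'

/-- Compactness supplies the strict gap above `a` that the contour shift spends on `ε` and on decay.
-/
lemma exists_gap {u : ℝ → ℂ} (hu : HasCompactSupport u) {a : ℝ} (h : tsupport u ⊆ Set.Ioi a) :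
    ∃ b, a < b ∧ tsupport u ⊆ Set.Ici b := by
  rcases (tsupport u).eq_empty_or_nonempty with h0 | h0
  · exact ⟨a + 1, by linarith, by simp [h0]⟩
  · obtain ⟨b, hb, hb'⟩ := hu.isCompact.exists_isLeast h0
    exact ⟨b, h hb, fun x hx => hb' hx⟩

lemma tsupport_comp_neg (u : ℝ → ℂ) : tsupport (fun ξ => u (-ξ)) = Neg.neg ⁻¹' tsupport u :=
  tsupport_comp_eq_preimage u (Homeomorph.neg ℝ)

lemma ExpType.comp_neg {a : ℝ} {f : ℂ → ℂ} (hf : f ∈ ExpType a) :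
    (fun z => f (-z)) ∈ ExpType a := by
  refine ⟨hf.1.comp differentiable_neg, fun ε hε => ?_⟩
  obtain ⟨C, hC, h⟩ := hf.2 ε hε
  exact ⟨C, hC, fun z => by simpa using h (-z)⟩

/-- The spectrum of a tame function of exponential type `a` is contained in `[-a, a]`. -/
lemma integral_mul_ftS_eq_zero {a : ℝ} (ha : 0 ≤ a) {f : ℂ → ℂ}
    (hf : f ∈ ExpType a) (hg : Tame (restrictReal f)) {u : ℝ → ℂ} (hu : IsTest u)
    (hs : tsupport u ⊆ Set.Ioi a ∨ tsupport u ⊆ Set.Iio (-a)) :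
    ∫ x, restrictReal f x * ftS hu.toSchwartz x = 0 := by
  have e : ∀ x, ftS hu.toSchwartz x = fourierInvT u (-x) := fun x => by
    rw [coe_ftS, fourierT_eq_fourierInvT_neg]; rfl
  simp_rw [e]
  rcases hs with hs | hs
  -- Since `ftS` is a reflected `fourierInvT`, positive frequencies are reached by reflecting `f`,
  -- negative ones by reflecting `u`.
  · obtain ⟨b, hab, hb⟩ := exists_gap hu.2.1 hs
    have h := integral_mul_fourierInvT_eq_zero_of_tame ha hab (ExpType.comp_neg hf)
      (f := fun z => f (-z)) (by
        have hn : restrictReal (fun z => f (-z)) = fun x => restrictReal f (-x) := by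
          funext x; simp [restrictReal]
        rw [hn]; exact hg.comp_neg) ⟨hu.1, hu.2.1, hb⟩
    rw [← h, ← integral_neg_eq_self]
    simp [restrictReal]
  · have hc : HasCompactSupport (fun ξ => u (-ξ)) := hu.2.1.comp_homeomorph (Homeomorph.neg ℝ)
    obtain ⟨b, hab, hb⟩ := exists_gap (a := a) hc (by
      rw [tsupport_comp_neg]
      intro x hx
      have := hs hx
      simp only [Set.mem_Iio, Set.mem_Ioi] at this ⊢
      linarith)
    have h := integral_mul_fourierInvT_eq_zero_of_tame ha hab hf hg
      (v := fun ξ => u (-ξ)) ⟨hu.1.comp contDiff_neg, hc, hb⟩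
    rw [← h]
    refine integral_congr_ae (ae_of_all _ fun x => ?_)
    simp only
    congr 1
    unfold fourierInvT
    congr 1
    rw [← integral_neg_eq_self]
    refine integral_congr_ae (ae_of_all _ fun ξ => ?_)
    simp

lemma integral_mul_iteratedDeriv {p η : ℝ → ℂ} (hp : ContDiff ℝ ∞ p) (hη : ContDiff ℝ ∞ η)
    (hc : HasCompactSupport η) (n : ℕ) :
    ∫ x, p x * iteratedDeriv n η x = (-1) ^ n * ∫ x, iteratedDeriv n p x * η x := by
  induction n generalizing p with
  | zero => simp
  | succ n ih =>
    set θ := iteratedDeriv n η with hθ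
    have hθs : ContDiff ℝ ∞ θ := by
      rw [hθ, iteratedDeriv_eq_iterate]
      exact hη.iterate_deriv n
    have hθc : HasCompactSupport θ := by
      rw [hθ]
      clear_value θ
      clear ih hθs hθ
      induction n with
      | zero => simpa using hc
      | succ n ih => rw [iteratedDeriv_succ]; exact ih.deriv
    have hd : ∀ x, HasDerivAt (fun x => p x * θ x) (deriv p x * θ x + p x * deriv θ x) x :=
      fun x => (hp.differentiable (by simp) x).hasDerivAt.mul
        (hθs.differentiable (by simp) x).hasDerivAt
    have i1 : Integrable (fun x => deriv p x * θ x) :=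
      ((hp.continuous_deriv (by simp)).mul hθs.continuous).integrable_of_hasCompactSupport
        hθc.mul_left
    have i2 : Integrable (fun x => p x * deriv θ x) :=
      (hp.continuous.mul (hθs.continuous_deriv (by simp))).integrable_of_hasCompactSupport
        hθc.deriv.mul_left
    have i3 : Integrable (fun x => p x * θ x) :=
      (hp.continuous.mul hθs.continuous).integrable_of_hasCompactSupport hθc.mul_left
    have hz := integral_eq_zero_of_hasDerivAt_of_integrable hd (i1.add i2) i3
    rw [integral_add i1 i2, ih hp.deriv'] at hz
    rw [iteratedDeriv_succ, iteratedDeriv_succ', pow_succ]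
    linear_combination hz

/-! ### Fractional Paley--Wiener spaces as images of `L²(-a, a)` -/

lemma eq_zero_of_iteratedDeriv_eq_zero {d : ℝ → ℂ} (hd : ContDiff ℝ ∞ d) (N : ℕ)
    (hN : iteratedDeriv N d = 0) (h0 : ∀ j < N, iteratedDeriv j d 0 = 0) : d = 0 := by
  induction N generalizing d with
  | zero => simpa using hN
  | succ N ih =>
    have h1 : deriv d = 0 := by
      refine ih hd.deriv' (by rw [← iteratedDeriv_succ', hN]) fun j hj => ?_
      rw [← iteratedDeriv_succ']
      exact h0 (j + 1) (by omega)
    funext x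
    have h2 := is_const_of_deriv_eq_zero (hd.differentiable (by simp)) (fun x => congrFun h1 x) x 0
    rw [h2]
    simpa using h0 0 (by omega)

lemma iteratedDeriv_ofReal_pow_eq_zero {k N : ℕ} (hk : k < N) :
    iteratedDeriv N (fun x : ℝ => (x : ℂ) ^ k) = 0 := by
  induction N generalizing k with
  | zero => omega
  | succ N ih =>
    rw [iteratedDeriv_succ']
    have hd : deriv (fun x : ℝ => (x : ℂ) ^ k) = fun x : ℝ => (k : ℂ) * (x : ℂ) ^ (k - 1) := by
      funext x
      exact (hasDerivAt_pow k (x : ℂ)).comp_ofReal.deriv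
    rw [hd]
    funext x
    rw [iteratedDeriv_const_mul_field]
    cases k with
    | zero => simp
    | succ k =>
      rw [Nat.add_sub_cancel, ih (by omega)]; simp

lemma contDiff_ofReal_pow (k : ℕ) : ContDiff ℝ ∞ fun x : ℝ => (x : ℂ) ^ k :=
  Complex.ofRealCLM.contDiff.pow k

/-- A smooth function vanishing to order `N` at `0` is determined modulo polynomials of degree
less than `N`. -/
lemma eq_of_integral_vanishing {N : ℕ} {f F : ℝ → ℂ} (hf : ContDiff ℝ ∞ f) (hF : ContDiff ℝ ∞ F)
    (hf0 : TaylorVanishes ((N : ℤ) - 1) f) (hF0 : TaylorVanishes ((N : ℤ) - 1) F)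
    (h : ∀ ψ ∈ SchwartzVanishing ((N : ℤ) - 1), ∫ x, f x * ψ x = ∫ x, F x * ψ x) : f = F := by
  have hd : ContDiff ℝ ∞ (f - F) := hf.sub hF
  have hNc : Continuous (iteratedDeriv N (f - F)) :=
    hd.continuous_iteratedDeriv N (by exact_mod_cast le_top)
  have key : ∀ᵐ x, iteratedDeriv N (f - F) x = 0 := by
    refine ae_eq_zero_of_integral_contDiff_smul_eq_zero hNc.locallyIntegrable ?_
    intro η hη hηs
    have hη' : ContDiff ℝ ∞ (fun x => (η x : ℂ)) := Complex.ofRealCLM.contDiff.comp hη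
    have hηc : HasCompactSupport (fun x => (η x : ℂ)) := hηs.comp_left Complex.ofReal_zero
    have hs : ContDiff ℝ ∞ (iteratedDeriv N (fun x => (η x : ℂ))) := by
      rw [iteratedDeriv_eq_iterate]; exact hη'.iterate_deriv N
    have hc : ∀ n, HasCompactSupport (iteratedDeriv n (fun x => (η x : ℂ))) := by
      intro n
      induction n with
      | zero => simpa using hηc
      | succ n ih => rw [iteratedDeriv_succ]; exact ih.deriv
    -- An `N`-th derivative annihilates polynomials of degree below `N`, so it is an admissible test
    -- function; testing with all of these gives `(f - F)^{(N)} = 0` weakly.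
    let ψ : 𝓢(ℝ, ℂ) := (hc N).toSchwartzMap hs
    have hψ : ∀ x, ψ x = iteratedDeriv N (fun x => (η x : ℂ)) x := fun x => rfl
    have hψm : ψ ∈ SchwartzVanishing ((N : ℤ) - 1) := by
      intro k hk
      simp_rw [hψ]
      rw [integral_mul_iteratedDeriv (contDiff_ofReal_pow k) hη' hηc,
        iteratedDeriv_ofReal_pow_eq_zero (by omega)]
      simp
    have h1 := h ψ hψm
    have i1 : Integrable (fun x => f x * ψ x) :=
      (hf.continuous.mul ψ.continuous).integrable_of_hasCompactSupport (hc N).mul_left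
    have i2 : Integrable (fun x => F x * ψ x) :=
      (hF.continuous.mul ψ.continuous).integrable_of_hasCompactSupport (hc N).mul_left
    have h2 : ∫ x, (f - F) x * iteratedDeriv N (fun x => (η x : ℂ)) x = 0 := by
      simp_rw [← hψ, Pi.sub_apply, sub_mul]
      rw [integral_sub i1 i2, h1, sub_self]
    rw [integral_mul_iteratedDeriv hd hη' hηc] at h2
    have h3 := (mul_eq_zero.1 h2).resolve_left (pow_ne_zero _ (by norm_num))
    rw [← h3]
    refine integral_congr_ae (ae_of_all _ fun x => ?_)
    simp [mul_comm]
  have hzero : iteratedDeriv N (f - F) = 0 :=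
    (Continuous.ae_eq_iff_eq volume hNc continuous_zero).1 key
  refine sub_eq_zero.1 (eq_zero_of_iteratedDeriv_eq_zero hd N hzero fun j hj => ?_)
  rw [iteratedDeriv_sub (hf.contDiffAt.of_le (by exact_mod_cast le_top))
    (hF.contDiffAt.of_le (by exact_mod_cast le_top)), hf0 j (by omega), hF0 j (by omega), sub_zero]

lemma eq_of_restrictReal_eq {f F : ℂ → ℂ} (hf : Differentiable ℂ f) (hF : Differentiable ℂ F)
    (h : restrictReal f = restrictReal F) : f = F := by
  have ht : Tendsto (fun x : ℝ => (x : ℂ)) (𝓝[≠] 0) (𝓝[≠] 0) := by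
    refine tendsto_nhdsWithin_iff.2 ⟨?_, ?_⟩
    · have : Tendsto (fun x : ℝ => (x : ℂ)) (𝓝 0) (𝓝 0) := by
        simpa using Complex.continuous_ofReal.tendsto 0
      exact this.mono_left nhdsWithin_le_nhds
    · filter_upwards [self_mem_nhdsWithin] with x hx
      simpa using hx
  refine AnalyticOnNhd.eq_of_frequently_eq (𝕜 := ℂ) (z₀ := 0)
    (fun z _ => hf.analyticAt z) (fun z _ => hF.analyticAt z) ?_
  exact ht.frequently (Eventually.frequently (Eventually.of_forall fun x => congrFun h x))

/-- The standing assumption `N - 1/2 < s < N + 1/2`, `s > 0`. -/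
structure Order (N : ℕ) (s : ℝ) : Prop where
  pos : 0 < s
  lower : (N : ℝ) - 1 / 2 < s
  upper : s < N + 1 / 2

namespace Order

variable {N : ℕ} {s : ℝ}

lemma floor_eq (h : Order N s) : ⌊s - 1 / 2⌋ = (N : ℤ) - 1 := by
  rw [Int.floor_eq_iff]
  have := h.lower
  have := h.upper
  push_cast
  constructor <;> linarith

lemma integrable_wt_mul (h : Order N s) {g : ℝ → ℂ} (hg : MemLp g 2 volume) {ψ : 𝓢(ℝ, ℂ)}
    (hψ : ψ ∈ SchwartzVanishing ((N : ℤ) - 1)) :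
    Integrable (fun ξ => wt s g ξ * fourierInvT ψ ξ) := by
  refine (hg.integrable_mul (memLp_abs_rpow_mul_fourierInvT h.pos.le h.upper hψ)).congr
    (ae_of_all _ fun ξ => ?_)
  simp [wt, mul_assoc]

/-- Transforms of test functions supported off `0` have all moments zero, so they are admissible for
every `N` and determine the density off `0`. -/
lemma density_unique (h : Order N s) {g₁ g₂ : ℝ → ℂ} (h₁ : MemLp g₁ 2 volume)
    (h₂ : MemLp g₂ 2 volume)
    (he : ∀ ψ ∈ SchwartzVanishing ((N : ℤ) - 1),
      ∫ ξ, wt s g₁ ξ * fourierInvT ψ ξ = ∫ ξ, wt s g₂ ξ * fourierInvT ψ ξ) :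
    g₁ =ᵐ[volume] g₂ := by
  have key := ae_eq_zero_of_integral_wt (s := s) (h₁.sub h₂) (U := {0}ᶜ) isOpen_compl_singleton
    (by simp) (fun u hu _ => by
      have hm := hu.ftS_mem ((N : ℤ) - 1)
      have i1 := h.integrable_wt_mul h₁ hm
      have i2 := h.integrable_wt_mul h₂ hm
      have h3 := he _ hm
      rw [hu.fourierInvT_ftS] at i1 i2 h3
      have e : ∀ ξ, wt s (g₁ - g₂) ξ * u ξ = wt s g₁ ξ * u ξ - wt s g₂ ξ * u ξ := fun ξ => by
        simp only [wt, Pi.sub_apply]; ring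
      rw [integral_congr_ae (ae_of_all _ e), integral_sub i1 i2, h3, sub_self])
  filter_upwards [key, ae_ne_zero] with ξ h4 h5
  exact sub_eq_zero.1 (h4 h5)

lemma tame_of_mem (h : Order N s) {f : ℂ → ℂ} {a : ℝ} (hf : f ∈ PW s a) :
    Tame (restrictReal f) := by
  obtain ⟨hE, ⟨hsmall, hlarge, -⟩, -⟩ := hf
  have hl := h.lower
  have hu := h.upper
  have hp := h.pos
  rcases N.eq_zero_or_pos with hN | hN
  · subst hN
    have hs : s < 1 / 2 := by simpa using hu
    have hγ : 0 < 1 / 2 - s := by linarith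
    refine Or.inr ⟨1 / (1 / 2 - s), ?_, ?_⟩
    · rw [le_div_iff₀ hγ]; linarith
    · have := (hsmall hs).integrable_norm_rpow (by simpa using hs) ENNReal.ofReal_ne_top
      rwa [ENNReal.toReal_ofReal (by positivity)] at this
  · have hN1 : (1:ℝ) ≤ N := by exact_mod_cast hN
    have hs : 1 / 2 < s := by linarith
    exact Or.inl (polyGrowth_of_homLipschitz (by linarith) (contDiff_restrictReal hE.1 _)
      (hlarge hs).1)

lemma taylorVanishes_of_mem (h : Order N s) {f : ℂ → ℂ} {a : ℝ} (hf : f ∈ PW s a) :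
    TaylorVanishes ((N : ℤ) - 1) (restrictReal f) := by
  obtain ⟨-, -, hT⟩ := hf
  rw [h.floor_eq] at hT
  rcases N.eq_zero_or_pos with hN | hN
  · subst hN
    intro j hj
    exfalso; push_cast at hj; omega
  · have hN1 : (1:ℝ) ≤ N := by exact_mod_cast hN
    exact hT (by linarith [h.lower])

lemma exists_bandFun_of_mem (h : Order N s) {a : ℝ} (ha : 0 ≤ a) {f : ℂ → ℂ} (hf : f ∈ PW s a) :
    ∃ g : ℝ → ℂ, MemLp g 2 volume ∧ (∀ ξ, ξ ∉ Set.Icc (-a) a → g ξ = 0) ∧ f = bandFun N s g := by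
  have hTame := h.tame_of_mem hf
  have hT := h.taylorVanishes_of_mem hf
  obtain ⟨hE, ⟨-, -, h₀, hh₀⟩, -⟩ := hf
  obtain ⟨g, -, hg⟩ := hh₀.exists_density h.pos.le h.upper h.floor_eq
  have hgm := Lp.memLp g
  have hz : ∀ U : Set ℝ, IsOpen U → (0:ℝ) ∉ U → (U ⊆ Set.Ioi a ∨ U ⊆ Set.Iio (-a)) →
      ∀ᵐ ξ, ξ ∈ U → g ξ = 0 := by
    intro U hU h0 hUs
    refine ae_eq_zero_of_integral_wt (s := s) hgm hU h0 fun u hu hus => ?_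
    have h1 := hg _ (hu.ftS_mem _)
    rw [hu.fourierInvT_ftS] at h1
    rw [← h1]
    exact integral_mul_ftS_eq_zero ha hE hTame hu (hUs.imp hus.trans hus.trans)
  have hz1 := hz (Set.Ioi a) isOpen_Ioi (by simpa using ha) (Or.inl subset_rfl)
  have hz2 := hz (Set.Iio (-a)) isOpen_Iio (by simpa using ha) (Or.inr subset_rfl)
  -- The density vanishes only almost everywhere outside `[-a, a]`; the truncation makes this
  -- pointwise without changing any integral.
  set g' := (Set.Icc (-a) a).indicator g with hg'
  have hgg : g' =ᵐ[volume] g := by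
    filter_upwards [hz1, hz2] with ξ h1 h2
    by_cases hξ : ξ ∈ Set.Icc (-a) a
    · rw [hg', Set.indicator_of_mem hξ]
    · rw [hg', Set.indicator_of_notMem hξ]
      rw [Set.mem_Icc, not_and_or, not_le, not_le] at hξ
      rcases hξ with h | h
      · exact (h2 h).symm
      · exact (h1 h).symm
  have hg'm : MemLp g' 2 volume := hgm.indicator measurableSet_Icc
  have hg's : ∀ ξ, ξ ∉ Set.Icc (-a) a → g' ξ = 0 := fun ξ hξ => Set.indicator_of_notMem hξ _
  refine ⟨g', hg'm, hg's, ?_⟩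
  have hEF := bandFun_mem_expType h.upper hg'm hg's
  refine eq_of_restrictReal_eq hE.1 hEF.1 ?_
  refine eq_of_integral_vanishing (N := N) (contDiff_restrictReal hE.1 _)
    (contDiff_restrictReal hEF.1 _) hT (taylorVanishes_bandFun h.upper hg'm hg's) fun ψ hψ => ?_
  rw [hg ψ hψ, integral_bandFun_mul h.upper hg'm hg's hψ]
  refine integral_congr_ae ?_
  filter_upwards [hgg] with ξ hξ
  simp only [wt, hξ]

lemma exists_hasFracLaplacian_bandFun (h : Order N s) {a : ℝ} {g : ℝ → ℂ}
    (hg : MemLp g 2 volume) (hga : ∀ ξ, ξ ∉ Set.Icc (-a) a → g ξ = 0) :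
    ∃ k, HasFracLaplacian s (restrictReal (bandFun N s g)) k := by
  refine exists_hasFracLaplacian h.pos.le h.upper h.floor_eq (hg.toLp g) fun ψ hψ => ?_
  rw [integral_bandFun_mul h.upper hg hga hψ]
  refine integral_congr_ae ?_
  filter_upwards [hg.coeFn_toLp] with ξ hξ
  simp only [wt, hξ]

lemma bandFun_mem (h : Order N s) {a : ℝ} {g : ℝ → ℂ}
    (hg : MemLp g 2 volume) (hga : ∀ ξ, ξ ∉ Set.Icc (-a) a → g ξ = 0) :
    bandFun N s g ∈ PW s a := by
  have hT := taylorVanishes_bandFun h.upper hg hga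
  have hl := h.lower
  have hu := h.upper
  refine ⟨bandFun_mem_expType h.upper hg hga, ⟨fun hs => ?_, fun hs => ?_,
    h.exists_hasFracLaplacian_bandFun hg hga⟩, fun _ => by rw [h.floor_eq]; exact hT⟩
  · have hN : N = 0 := by
      have : (N : ℝ) < 1 := by linarith
      exact_mod_cast Nat.lt_one_iff.1 (by exact_mod_cast this)
    subst hN
    exact memLp_bandFun h.pos hs hg hga
  · refine ⟨?_, by rw [h.floor_eq]; exact hT⟩
    obtain ⟨m, rfl⟩ : ∃ m, N = m + 1 := by
      refine Nat.exists_eq_succ_of_ne_zero fun h0 => ?_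
      rw [h0] at hu
      simp at hu
      linarith
    push_cast at hl hu
    exact homLipschitz_bandFun (by linarith) hu hg hga

/-- Whichever fractional Laplacian is chosen, it has the norm of some density of the function, and
the density is unique. -/
lemma pwNorm_bandFun (h : Order N s) {a : ℝ} {g : ℝ → ℂ}
    (hg : MemLp g 2 volume) (hga : ∀ ξ, ξ ∉ Set.Icc (-a) a → g ξ = 0) :
    pwNorm s (bandFun N s g) = (eLpNorm g 2 volume).toReal := by
  have hex := h.exists_hasFracLaplacian_bandFun hg hga
  unfold pwNorm fracLaplacian
  rw [dif_pos hex]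
  obtain ⟨g₂, hn, hp⟩ := hex.choose_spec.exists_density h.pos.le h.upper h.floor_eq
  rw [← hn, Lp.norm_def]
  congr 1
  refine eLpNorm_congr_ae (h.density_unique (Lp.memLp g₂) hg fun ψ hψ => ?_)
  rw [← hp ψ hψ, integral_bandFun_mul h.upper hg hga hψ]

lemma bandFun_injective (h : Order N s) {a : ℝ} {g₁ g₂ : ℝ → ℂ}
    (h₁ : MemLp g₁ 2 volume) (ha₁ : ∀ ξ, ξ ∉ Set.Icc (-a) a → g₁ ξ = 0)
    (h₂ : MemLp g₂ 2 volume) (ha₂ : ∀ ξ, ξ ∉ Set.Icc (-a) a → g₂ ξ = 0)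
    (he : bandFun N s g₁ = bandFun N s g₂) : g₁ =ᵐ[volume] g₂ := by
  refine h.density_unique h₁ h₂ fun ψ hψ => ?_
  rw [← integral_bandFun_mul h.upper h₁ ha₁ hψ, ← integral_bandFun_mul h.upper h₂ ha₂ hψ, he]

end Order

/-! ### The reproducing kernel -/

/-- The Hilbert space `L²(-a, a)`. -/
abbrev BandL2 (a : ℝ) : Type := Lp ℂ 2 (volume.restrict (Set.Icc (-a) a))

/-- Extension by zero. -/
noncomputable def extZero (a : ℝ) (G : BandL2 a) : ℝ → ℂ := (Set.Icc (-a) a).indicator G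

lemma memLp_extZero {a : ℝ} (G : BandL2 a) : MemLp (extZero a G) 2 volume :=
  (memLp_indicator_iff_restrict measurableSet_Icc).2 (Lp.memLp G)

lemma extZero_eq_zero {a : ℝ} (G : BandL2 a) (ξ : ℝ) (hξ : ξ ∉ Set.Icc (-a) a) :
    extZero a G ξ = 0 := Set.indicator_of_notMem hξ _

lemma eLpNorm_extZero {a : ℝ} (G : BandL2 a) :
    (eLpNorm (extZero a G) 2 volume).toReal = ‖G‖ := by
  rw [Lp.norm_def, extZero, eLpNorm_indicator_eq_eLpNorm_restrict measurableSet_Icc]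

/-- The density `(2π)^{-1/2} |ξ|^{-s} E_N(izξ)` of the evaluation at `z`. -/
noncomputable def evalDensity (N : ℕ) (s : ℝ) (z : ℂ) (ξ : ℝ) : ℂ :=
  fc * ((|ξ| ^ (-s) : ℝ) : ℂ) * expRem N (Complex.I * z * ξ)

lemma memLp_evalDensity {N : ℕ} {s : ℝ} (hsN : s < N + 1 / 2) (a : ℝ) (z : ℂ) :
    MemLp (evalDensity N s z) 2 (volume.restrict (Set.Icc (-a) a)) := by
  have h := ((memLp_indicator_iff_restrict measurableSet_Icc).1
    (memLp_indicator_pow_mul_rpow hsN a)).const_mul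
      (‖fc‖ * (‖z‖ ^ N * Real.exp (‖z‖ * a)))
  refine h.mono ?_ ((ae_restrict_iff' measurableSet_Icc).2 (ae_of_all _ fun ξ hξ => ?_))
  · refine AEStronglyMeasurable.mul
      ((measurable_abs_rpow (-s)).const_mul fc).aestronglyMeasurable ?_
    exact ((continuous_expRem N).comp (by fun_prop)).aestronglyMeasurable
  · have hξa : |ξ| ≤ a := abs_le.2 hξ
    have h1 : ‖Complex.I * z * ξ‖ = ‖z‖ * |ξ| := by simp
    have h2 := norm_expRem_le N (Complex.I * z * ξ)
    rw [h1] at h2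
    rw [evalDensity, norm_mul, norm_mul, Complex.norm_real,
      Real.norm_of_nonneg (Real.rpow_nonneg (abs_nonneg ξ) _)]
    refine le_trans ?_ (le_abs_self _)
    calc ‖fc‖ * |ξ| ^ (-s) * ‖expRem N (Complex.I * z * ξ)‖
        ≤ ‖fc‖ * |ξ| ^ (-s) * ((‖z‖ * |ξ|) ^ N * Real.exp (‖z‖ * |ξ|)) := by gcongr
      _ ≤ ‖fc‖ * |ξ| ^ (-s) * ((‖z‖ * |ξ|) ^ N * Real.exp (‖z‖ * a)) := by gcongr
      _ = _ := by rw [mul_pow]; ring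

/-- The element of `L²(-a, a)` representing the evaluation at `z`. -/
noncomputable def evalVec {N : ℕ} {s : ℝ} (h : Order N s) (a : ℝ) (z : ℂ) : BandL2 a :=
  (memLp_evalDensity h.upper a z).star.toLp _

lemma coeFn_evalVec {N : ℕ} {s : ℝ} (h : Order N s) (a : ℝ) (z : ℂ) :
    evalVec h a z =ᵐ[volume.restrict (Set.Icc (-a) a)]
      fun ξ => starRingEnd ℂ (evalDensity N s z ξ) :=
  (memLp_evalDensity h.upper a z).star.coeFn_toLp

lemma inner_evalVec {N : ℕ} {s : ℝ} (h : Order N s) {a : ℝ} (z : ℂ) (G : BandL2 a) :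
    inner ℂ (evalVec h a z) G = bandFun N s (extZero a G) z := by
  rw [L2.inner_def, bandFun, bandInt, ← integral_const_mul]
  have e : ∀ ξ : ℝ, fc * (wt s (extZero a G) ξ * expRem N (Complex.I * z * ξ)) =
      (Set.Icc (-a) a).indicator (fun ξ => evalDensity N s z ξ * G ξ) ξ := by
    intro ξ
    by_cases hξ : ξ ∈ Set.Icc (-a) a
    · simp only [wt, extZero, Set.indicator_of_mem hξ, evalDensity]; ring
    · simp [wt, extZero, Set.indicator_of_notMem hξ]
  rw [integral_congr_ae (ae_of_all _ e), integral_indicator measurableSet_Icc]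
  refine integral_congr_ae ?_
  filter_upwards [coeFn_evalVec h a z] with ξ hξ
  rw [hξ, RCLike.inner_apply, RingHomCompTriple.comp_apply, RingHom.id_apply, mul_comm]

/-- The integrand of the reproducing kernel, for all `N`. -/
noncomputable def kernelIntegrand (N : ℕ) (s : ℝ) (w z : ℂ) (ξ : ℝ) : ℂ :=
  expRem N (Complex.I * w * ξ) * expRem N (-(Complex.I * starRingEnd ℂ z * ξ)) *
    ((|ξ| ^ (-2 * s) : ℝ) : ℂ)

lemma evalDensity_mul_star {N : ℕ} {s : ℝ} (w z : ℂ) {ξ : ℝ} (hξ : ξ ≠ 0) :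
    evalDensity N s w ξ * starRingEnd ℂ (evalDensity N s z ξ) =
      1 / (2 * (Real.pi : ℂ)) * kernelIntegrand N s w z ξ := by
  have hpos : 0 < |ξ| := abs_pos.2 hξ
  have h1 : ((|ξ| ^ (-s) : ℝ) : ℂ) * ((|ξ| ^ (-s) : ℝ) : ℂ) = ((|ξ| ^ (-2 * s) : ℝ) : ℂ) := by
    rw [← Complex.ofReal_mul, ← Real.rpow_add hpos]
    congr 2; ring
  have h2 : starRingEnd ℂ (Complex.I * z * ξ) = -(Complex.I * starRingEnd ℂ z * ξ) := by
    simp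
  simp only [evalDensity, kernelIntegrand, map_mul, star_fc, star_expRem, Complex.conj_ofReal]
  rw [← map_mul, ← Complex.conj_ofReal ξ, ← map_mul, Complex.conj_ofReal, h2, ← h1, one_div,
    ← fc_mul_fc]
  ring

lemma intervalIntegrable_kernelIntegrand {N : ℕ} {s : ℝ} (h : Order N s) {a : ℝ} (ha : 0 ≤ a)
    (w z : ℂ) : IntervalIntegrable (kernelIntegrand N s w z) volume (-a) a := by
  rw [intervalIntegrable_iff_integrableOn_Icc_of_le (by linarith)]
  have hi := ((memLp_evalDensity h.upper a w).integrable_mul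
    (memLp_evalDensity h.upper a z).star).const_mul (2 * (Real.pi : ℂ))
  refine hi.congr ?_
  filter_upwards [ae_restrict_of_ae ae_ne_zero] with ξ hξ
  have h1 := evalDensity_mul_star (N := N) (s := s) w z hξ
  have hpi : (Real.pi : ℂ) ≠ 0 := by exact_mod_cast Real.pi_ne_zero
  change 2 * (Real.pi : ℂ) * (evalDensity N s w ξ * starRingEnd ℂ (evalDensity N s z ξ)) = _
  rw [h1]
  field_simp

/-- The inner product conjugates its first argument and `evalVec` is already conjugated, so the
integrand is the density at `w` times the conjugate of the one at `z`; `fc * fc` gives `1/(2π)`. -/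
lemma inner_evalVec_evalVec {N : ℕ} {s : ℝ} (h : Order N s) {a : ℝ} (ha : 0 ≤ a) (w z : ℂ) :
    inner ℂ (evalVec h a w) (evalVec h a z) =
      1 / (2 * (Real.pi : ℂ)) * ∫ ξ in (-a)..a, kernelIntegrand N s w z ξ := by
  rw [L2.inner_def, intervalIntegral.integral_of_le (by linarith), ← integral_Icc_eq_integral_Ioc,
    ← integral_const_mul]
  refine integral_congr_ae ?_
  filter_upwards [coeFn_evalVec h a w, coeFn_evalVec h a z, ae_restrict_of_ae ae_ne_zero]
    with ξ h1 h2 h3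
  rw [h1, h2, RCLike.inner_apply, RingHomCompTriple.comp_apply, RingHom.id_apply, mul_comm]
  exact evalDensity_mul_star w z h3

/-- The fractional Paley--Wiener space as a reproducing kernel Hilbert space, modelled on
`L²(-a, a)`. -/
noncomputable abbrev bandRKHS {N : ℕ} {s : ℝ} (h : Order N s) (a : ℝ) :
    RKHS ℂ (BandL2 a) ℂ ℂ where
  coeCLM := ContinuousLinearMap.pi fun z => innerSL ℂ (evalVec h a z)
  coeCLM_injective G₁ G₂ he := by
    have he' : bandFun N s (extZero a G₁) = bandFun N s (extZero a G₂) := by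
      funext z
      rw [← inner_evalVec h, ← inner_evalVec h]
      exact congrFun he z
    have hae := h.bandFun_injective (memLp_extZero G₁) (extZero_eq_zero G₁) (memLp_extZero G₂)
      (extZero_eq_zero G₂) he'
    refine Lp.ext ?_
    have hae' := (ae_restrict_iff' (μ := volume) (s := Set.Icc (-a) a)
      (p := fun ξ => G₁ ξ = G₂ ξ) measurableSet_Icc).2 (by
        filter_upwards [hae] with ξ h1 h2
        simpa only [extZero, Set.indicator_of_mem h2] using h1)
    exact hae'

lemma isRKHSWithKernel_PW {N : ℕ} {s : ℝ} (h : Order N s) {a : ℝ} (ha : 0 ≤ a) :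
    IsRKHSWithKernel (PW s a) (pwNorm s)
      (fun w z => 1 / (2 * (Real.pi : ℂ)) * ∫ ξ in (-a)..a, kernelIntegrand N s w z ξ) := by
  let _ := bandRKHS h a
  have hcoe : ∀ G : BandL2 a, (fun z => RKHS.coeCLM ℂ G z) = bandFun N s (extZero a G) := by
    intro G
    funext z
    exact inner_evalVec h z G
  refine ⟨BandL2 a, inferInstance, inferInstance, inferInstance, bandRKHS h a, ?_, ?_, ?_⟩
  · ext f
    constructor
    · rintro ⟨G, rfl⟩
      change (fun z => RKHS.coeCLM ℂ G z) ∈ _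
      rw [hcoe]
      exact h.bandFun_mem (memLp_extZero G) (extZero_eq_zero G)
    · intro hf
      obtain ⟨g, hg, hga, rfl⟩ := h.exists_bandFun_of_mem ha hf
      have hg' : MemLp g 2 (volume.restrict (Set.Icc (-a) a)) := hg.restrict _
      refine ⟨hg'.toLp g, ?_⟩
      change (fun z => RKHS.coeCLM ℂ (hg'.toLp g) z) = _
      rw [hcoe]
      have hae : extZero a (hg'.toLp g) =ᵐ[volume] g := by
        have h1 := (ae_restrict_iff' measurableSet_Icc).1 hg'.coeFn_toLp
        filter_upwards [h1] with ξ hξ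
        by_cases hm : ξ ∈ Set.Icc (-a) a
        · rw [extZero, Set.indicator_of_mem hm, hξ hm]
        · rw [extZero, Set.indicator_of_notMem hm, hga ξ hm]
      funext z
      unfold bandFun bandInt
      congr 1
      refine integral_congr_ae ?_
      filter_upwards [hae] with ξ hξ
      simp only [wt, hξ]
  · intro G
    change _ = pwNorm s (fun z => RKHS.coeCLM ℂ G z)
    rw [hcoe, h.pwNorm_bandFun (memLp_extZero G) (extZero_eq_zero G), eLpNorm_extZero]
  · intro w z
    -- The kernel section at `z` is the Riesz representative of the evaluation, so the kernel is the
    -- Gram function of the vectors `evalVec`.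
    have hk : RKHS.kerFun (BandL2 a) z (1 : ℂ) = evalVec h a z := by
      refine ext_inner_right ℂ fun G => ?_
      rw [RKHS.kerFun_inner]
      change inner ℂ (1 : ℂ) (inner ℂ (evalVec h a z) G) = _
      simp
    rw [← RKHS.kerFun_apply, hk]
    exact inner_evalVec_evalVec h ha w z

lemma kernelIntegrand_zero (s : ℝ) (w z : ℂ) :
    kernelIntegrand 0 s w z = kernelIntegrandSmall s w z := by
  funext ξ
  simp only [kernelIntegrand, kernelIntegrandSmall, expRem_zero]
  rw [← Complex.exp_add]
  congr 2
  ring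

/-- Definitional: the sum over `range (m + 1)` subtracted in `expRem (m + 1)` is `P_m`. -/
lemma kernelIntegrand_floor_add_one (s : ℝ) (w z : ℂ) :
    kernelIntegrand (⌊s - 1 / 2⌋₊ + 1) s w z = kernelIntegrandLarge s w z := rfl

end FracPW

theorem mainTheorem8 (s a : ℝ) (hs : 0 < s) (ha : 0 < a)
    (hcrit : ∀ n : ℕ, s - 1 / 2 ≠ (n : ℝ)) :
    (s < 1 / 2 →
      (∀ w z : ℂ, IntervalIntegrable (FracPW.kernelIntegrandSmall s w z) volume (-a) a) ∧
      FracPW.IsRKHSWithKernel (FracPW.PW s a) (FracPW.pwNorm s)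
        (fun w z => (1 / (2 * (Real.pi : ℂ))) *
          ∫ ξ in (-a)..a, FracPW.kernelIntegrandSmall s w z ξ)) ∧
    (1 / 2 < s →
      (∀ w z : ℂ, IntervalIntegrable (FracPW.kernelIntegrandLarge s w z) volume (-a) a) ∧
      FracPW.IsRKHSWithKernel (FracPW.PW s a) (FracPW.pwNorm s)
        (fun w z => (1 / (2 * (Real.pi : ℂ))) *
          ∫ ξ in (-a)..a, FracPW.kernelIntegrandLarge s w z ξ)) := by
  refine ⟨fun h => ?_, fun h => ?_⟩
  · have hO : FracPW.Order 0 s := ⟨hs, by push_cast; linarith, by push_cast; linarith⟩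
    simp_rw [← FracPW.kernelIntegrand_zero]
    exact ⟨FracPW.intervalIntegrable_kernelIntegrand hO ha.le, FracPW.isRKHSWithKernel_PW hO ha.le⟩
  · have hO : FracPW.Order (⌊s - 1 / 2⌋₊ + 1) s := by
      have h1 := Nat.floor_le (show 0 ≤ s - 1 / 2 by linarith)
      have h2 := Nat.lt_floor_add_one (s - 1 / 2)
      -- Noncriticality makes the lower bound `N - 1/2 < s` strict, as the Hölder estimate needs.
      have h3 := lt_of_le_of_ne h1 (hcrit _).symm
      refine ⟨hs, ?_, ?_⟩ <;> push_cast <;> linarith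
    simp_rw [← FracPW.kernelIntegrand_floor_add_one]
    exact ⟨FracPW.intervalIntegrable_kernelIntegrand hO ha.le, FracPW.isRKHSWithKernel_PW hO ha.le⟩
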